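/- **Lemma 2.2 (uniform $L^\infty$ bound on $u_\varepsilon$).** Let $n\ge 2$, and let $\Omega_0,\Omega\subset\mathbb R^n$ be bounded, smooth, convex domains with $\overline{\Omega_0}\subset\Omega$ and $\Omega$ uniformly convex. Fix a smooth uniformly convex defining function $\rho$ of $\Omega$, that is, $\Omega=\{\rho<0\}$, $\rho=0$ and $D\rho\ne0$ on $\partial\Omega$. Let $\varphi\in C^5(\overline\Omega)$ be convex and let $\psi\in C^3(\overline\Omega)$ satisfy $\min_{\partial\Omega}\psi>0$. Let $f_k,g_k:[0,\infty)\to[0,\infty)$, $0\le k\le 3$, be smooth, convex and increasing (not necessarily strictly), and put $$H(x)=x\bigl(1+f_0(x)g_0(x)+f_2(x)g_2(x)+x f_3(x)g_3(x)\bigr)\quad (x\ge 0),\qquad G(x)=\int_0^{x^2}H(t)\,dt\quad (x\in\mathbb R).$$ Call $F=F(x,z,\mathbf p):\mathbb R^n\times\mathbb R\times\mathbb R^n\to\mathbb R$ *admissible* if $F$ is smooth, convex in $z$ and convex in $\mathbf p$, and for all $x\in\Omega_0$, $z\in\mathbb R$, $\mathbf p\in\mathbb R^n$ and $1\le i\le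 n$, $$|F_z|+|F_{p_i}|\le f_0(|z|)g_0(|\mathbf p|),\qquad 0\le (F_{p_kp_l})_{k,l}\le f_1(|z|)g_1(|\mathbf p|)I_n,$$ $$\Bigl|\sum_{k=1}^n F_{p_kx_k}\Bigr|\le f_2(|z|)g_2(|\mathbf p|),\qquad |F_{p_iz}|\le f_3(|z|)g_3(|\mathbf p|).$$ For $\varepsilon>0$ set $\widetilde\varphi_\varepsilon=\varphi+\varepsilon^{1/(3n^2)}(e^\rho-1)$ and consider the second boundary value problem $$\left\{\begin{aligned}\varepsilon\sum_{i,j}U_\varepsilon^{ij}D_{ij}w_\varepsilon&=f_\varepsilon:=\Bigl(F_z(x,u_\varepsilon,Du_\varepsilon)-\sum_i\frac{\partial}{\partial x_i}\bigl(F_{p_i}(x,u_\varepsilon,Du_\varepsilon)\bigr)\Bigr)\chi_{\Omega_0}+\frac{G'(u_\varepsilon-\widetilde\varphi_\varepsilon)}{\varepsilon}\chi_{\Omega\setminus\Omega_0}&&\text{in }\Omega,\\ w_\varepsilon&=(\det D^2u_\varepsilon)^{-1}&&\text{in }\Omega,\\ u_\varepsilon&=\varphi,\quad w_\varepsilon=\psi&&\text{on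 }\partial\Omega,\end{aligned}\right.\qquad(\ast)$$ where $(U_\varepsilon^{ij})$ is the cofactor matrix of $D^2u_\varepsilon$ and $D_{ij}w_\varepsilon$ are weak derivatives, the first equation holding almost everywhere. Then there is $\varepsilon_0\in(0,1)$, depending only on $n,\Omega,\Omega_0,\rho,\varphi,\psi,f_k,g_k$, and for every $s\in(n,\infty)$ there is a constant $C_{14}>0$, depending only on $n,s,\Omega,\Omega_0,\rho,\varphi,\psi,f_k,g_k$, such that for every admissible $F$, every $0<\varepsilon<\varepsilon_0$ and every uniformly convex solution $u_\varepsilon\in W^{4,s}(\Omega)$ of $(\ast)$, $$\|u_\varepsilon\|_{L^\infty(\Omega)}<C_{14}.$$ -/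

import Mathlib

open MeasureTheory Set Filter Topology
open scoped ContDiff ENNReal

noncomputable section

namespace SingularAbreu

/-- Euclidean space `ℝⁿ`. -/
abbrev E (n : ℕ) : Type := EuclideanSpace ℝ (Fin n)

variable {n : ℕ}

/-! ### Classical and weak derivatives -/

/-- The `i`-th standard basis vector. -/
def basisVec (i : Fin n) : E n := EuclideanSpace.single i (1 : ℝ)

/-- The classical partial derivative `D_i f (x)`. -/
def pd (i : Fin n) (f : E n → ℝ) (x : E n) : ℝ := fderiv ℝ f x (basisVec i)

/-- The classical Hessian matrix `D²f(x) = (D_{ij} f(x))`. -/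
def hess (f : E n → ℝ) (x : E n) : Matrix (Fin n) (Fin n) ℝ :=
  Matrix.of fun i j => pd j (pd i f) x

/-- The cofactor matrix of the (symmetric) Hessian, `(det D²f) (D²f)⁻¹` where `D²f` is invertible. -/
def cofHess (f : E n → ℝ) (x : E n) : Matrix (Fin n) (Fin n) ℝ := (hess f x).adjugate

/-- `v` is the weak partial derivative of `u` in the direction `i` on the open set `Ω`. -/
structure HasWeakPartialDeriv (Ω : Set (E n)) (i : Fin n) (u v : E n → ℝ) : Prop where
  locInt_fun : LocallyIntegrableOn u Ω volume
  locInt_deriv : LocallyIntegrableOn v Ω volume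
  integral_eq : ∀ η : E n → ℝ, ContDiff ℝ ∞ η → HasCompactSupport η → tsupport η ⊆ Ω →
    ∫ x in Ω, u x * pd i η x = - ∫ x in Ω, v x * η x

/-- The Sobolev space `W^{k,p}(Ω)`: all weak derivatives up to order `k` exist and are in `L^p(Ω)`. -/
def MemSobolev (Ω : Set (E n)) (p : ℝ≥0∞) : ℕ → (E n → ℝ) → Prop
  | 0, u => MemLp u p (volume.restrict Ω)
  | k + 1, u => MemLp u p (volume.restrict Ω) ∧
      ∀ i : Fin n, ∃ v : E n → ℝ, HasWeakPartialDeriv Ω i u v ∧ MemSobolev Ω p k v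

/-! ### Domains -/

/-- A domain with smooth boundary: near each boundary point it is a sublevel set `{r < 0}` of a
smooth function `r` with `Dr ≠ 0`. -/
structure IsSmoothDomain (Ω : Set (E n)) : Prop where
  isOpen : IsOpen Ω
  isConnected : IsConnected Ω
  smooth_boundary : ∀ x ∈ frontier Ω, ∃ r : E n → ℝ,
    ContDiff ℝ ∞ r ∧ fderiv ℝ r x ≠ 0 ∧ ∀ᶠ y in 𝓝 x, (y ∈ Ω ↔ r y < 0)

/-- `ρ` is a uniformly convex (smooth) defining function of `Ω`. A bounded smooth domain is
uniformly convex when it has such a function. -/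
structure IsUniformlyConvexDefiningFunction (Ω : Set (E n)) (ρ : E n → ℝ) : Prop where
  smooth : ContDiff ℝ ∞ ρ
  neg_iff : {x | ρ x < 0} = Ω
  eq_zero : ∀ x ∈ frontier Ω, ρ x = 0
  fderiv_ne_zero : ∀ x ∈ frontier Ω, fderiv ℝ ρ x ≠ 0
  uniformly_convex : ∃ m : ℝ, 0 < m ∧ StrongConvexOn (closure Ω) m ρ

/-! ### The Lagrangian -/

/-- `∂F/∂z`. -/
def Fz (F : E n → ℝ → E n → ℝ) (x : E n) (z : ℝ) (p : E n) : ℝ := deriv (fun t => F x t p) z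

/-- `∂F/∂p_i`. -/
def Fp (F : E n → ℝ → E n → ℝ) (i : Fin n) (x : E n) (z : ℝ) (p : E n) : ℝ :=
  pd i (fun q => F x z q) p

/-- The matrix `(F_{p_i p_j})`. -/
def Fpp (F : E n → ℝ → E n → ℝ) (x : E n) (z : ℝ) (p : E n) : Matrix (Fin n) (Fin n) ℝ :=
  Matrix.of fun i j => pd j (fun q => Fp F i x z q) p

/-- `F_{p_i x_i}` for a single index `i` (no summation). -/
def Fpx (F : E n → ℝ → E n → ℝ) (i : Fin n) (x : E n) (z : ℝ) (p : E n) : ℝ :=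
  pd i (fun y => Fp F i y z p) x

/-- `F_{p_i z}`. -/
def Fpz (F : E n → ℝ → E n → ℝ) (i : Fin n) (x : E n) (z : ℝ) (p : E n) : ℝ :=
  deriv (fun t => Fp F i x t p) z

/-- A smooth, convex, increasing function from `[0,∞)` to `[0,∞)`. -/
structure IsGrowthFunction (η : ℝ → ℝ) : Prop where
  smooth : ContDiffOn ℝ ∞ η (Ici 0)
  convex : ConvexOn ℝ (Ici 0) η
  mono : MonotoneOn η (Ici 0)
  nonneg : ∀ t : ℝ, 0 ≤ t → 0 ≤ η t

/-- Smoothness and convexity in `z` and in `p`, and growth of the derivatives over `Ω₀`, controlled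
by the functions `f 0, …, f 3` and `g 0, …, g 3`. -/
structure IsAdmissibleLagrangian (Ω₀ : Set (E n)) (f g : Fin 4 → ℝ → ℝ)
    (F : E n → ℝ → E n → ℝ) : Prop where
  smooth : ContDiff ℝ ∞ (fun q : E n × ℝ × E n => F q.1 q.2.1 q.2.2)
  convex_z : ∀ x p, ConvexOn ℝ univ (fun z => F x z p)
  convex_p : ∀ x z, ConvexOn ℝ univ (fun p => F x z p)
  bound_first : ∀ x ∈ Ω₀, ∀ z p, ∀ i : Fin n, |Fz F x z p| + |Fp F i x z p| ≤ f 0 |z| * g 0 ‖p‖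
  bound_pp_lower : ∀ x ∈ Ω₀, ∀ z p, (Fpp F x z p).PosSemidef
  bound_pp_upper : ∀ x ∈ Ω₀, ∀ z p,
    ((f 1 |z| * g 1 ‖p‖) • (1 : Matrix (Fin n) (Fin n) ℝ) - Fpp F x z p).PosSemidef
  bound_px : ∀ x ∈ Ω₀, ∀ z p, |∑ i : Fin n, Fpx F i x z p| ≤ f 2 |z| * g 2 ‖p‖
  bound_pz : ∀ x ∈ Ω₀, ∀ z p, ∀ i : Fin n, |Fpz F i x z p| ≤ f 3 |z| * g 3 ‖p‖

/-! ### The penalization and the boundary value problem -/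

/-- `H(x) = x (1 + f₀(x) g₀(x) + f₂(x) g₂(x) + x f₃(x) g₃(x))`. -/
def H (f g : Fin 4 → ℝ → ℝ) (x : ℝ) : ℝ :=
  x * (1 + f 0 x * g 0 x + f 2 x * g 2 x + x * (f 3 x * g 3 x))

/-- `G(x) = ∫₀^{x²} H(t) dt`. -/
def G (f g : Fin 4 → ℝ → ℝ) (x : ℝ) : ℝ := ∫ t in (0 : ℝ)..x ^ 2, H f g t

/-- `φ̃_ε = φ + ε^{1/(3n²)} (e^ρ - 1)`. -/
def phiTilde (φ ρ : E n → ℝ) (ε : ℝ) (x : E n) : ℝ :=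
  φ x + ε ^ (1 / (3 * (n : ℝ) ^ 2)) * (Real.exp (ρ x) - 1)

/-- The right-hand side `f_ε` of the equation, for the function `u`. -/
def rhs (Ω Ω₀ : Set (E n)) (φ ρ : E n → ℝ) (f g : Fin 4 → ℝ → ℝ) (F : E n → ℝ → E n → ℝ)
    (ε : ℝ) (u : E n → ℝ) (x : E n) : ℝ :=
  Ω₀.indicator (fun x => Fz F x (u x) (gradient u x)
    - ∑ i : Fin n, pd i (fun y => Fp F i y (u y) (gradient u y)) x) x
  + (Ω \ Ω₀).indicator (fun x => deriv (G f g) (u x - phiTilde φ ρ ε x) / ε) x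

/-- `u` is a uniformly convex `W^{4,s}(Ω)` solution of the second boundary value problem
`ε U^{ij} D_{ij} w = f_ε`, `w = (det D²u)⁻¹` in `Ω`, `u = φ`, `w = ψ` on `∂Ω`.

Here `u` and `w` are the representatives that are continuous on the closure of `Ω`, so that the
boundary values are attained pointwise. For `s > n`, the continuous representative of a function in
`W^{4,s}(Ω)` is of class `C³` in `Ω`, so `Du`, `D²u` and the divergence in `f_ε` are classical; the
second derivatives of `w` are weak ones and the equation for `w` holds almost everywhere. -/
structure IsSolution (Ω Ω₀ : Set (E n)) (φ ψ ρ : E n → ℝ) (f g : Fin 4 → ℝ → ℝ)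
    (F : E n → ℝ → E n → ℝ) (s ε : ℝ) (u w : E n → ℝ) : Prop where
  memSobolev : MemSobolev Ω (ENNReal.ofReal s) 4 u
  continuousOn_u : ContinuousOn u (closure Ω)
  uniformly_convex : ∃ c : ℝ, 0 < c ∧ StrongConvexOn Ω c u
  continuousOn_w : ContinuousOn w (closure Ω)
  w_eq : ∀ x ∈ Ω, w x = ((hess u x).det)⁻¹
  equation : ∃ (w₁ : Fin n → E n → ℝ) (w₂ : Fin n → Fin n → E n → ℝ),
    (∀ i, HasWeakPartialDeriv Ω i w (w₁ i)) ∧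
    (∀ i j, HasWeakPartialDeriv Ω j (w₁ i) (w₂ i j)) ∧
    ∀ᵐ x ∂(volume.restrict Ω),
      ε * ∑ i : Fin n, ∑ j : Fin n, cofHess u x i j * w₂ i j x = rhs Ω Ω₀ φ ρ f g F ε u x
  u_boundary : ∀ x ∈ frontier Ω, u x = φ x
  w_boundary : ∀ x ∈ frontier Ω, w x = ψ x

end SingularAbreu

end

noncomputable section

namespace SingularAbreu

variable {n : ℕ}

open scoped Convolution
open ContinuousLinearMap (lsmul)

/-! The upper bound is the maximum principle: a strictly convex function is at most the maximum of
its boundary values, here those of `φ`. The lower bound is an energy argument.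

Put `v = u - φ̃_ε`, which vanishes on the boundary, and test the equation with `η = γ(v)`, where `γ
= cutoff` is nonpositive, nondecreasing, concave and zero on `[-1, ∞)`, so that `η` has compact
support in `Ω`. The cofactor matrix is divergence free, so two integrations by parts
(`integral_cofHess_mul`) put both derivatives on `η`. Since `w = 1 / det D²u`, `U^{ij} D_{ij} u = n
det D²u`, `φ̃_ε` is convex and `γ` is concave, the resulting integrand is at most `n γ'(v)`
(`inv_det_mul_sum_cofHess_cutoff_le`). Hence the tested right-hand side is at most a multiple of `ε
(max |v|)²`.

For the reverse inequality let `M = -min u` be large. Shrinking `Ω` by a factor `τ < 1` towards the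
minimum point gives, by convexity, a set on which `v ≤ -m` with `m` comparable to `M`. For `τ` near
`1` its part `S` outside `Ω₀` has measure at least `τ^n |Ω| - |Ω₀| > 0`, and there the penalization
contributes at least a multiple of `m⁴ H(m²) / ε`. On `Ω₀` both `|u|` and `|Du|` are at most `m²`,
so the Euler–Lagrange term costs at most `T V³ |Ω₀|`, with `V` of order `m` bounding `|v|` and `m² T
≤ n H(m²)`: the function `H` is built for exactly this comparison. The power of `m` on the good side
is larger, so `m` is bounded (`le_of_energy`, `IsSolution.neg_le`) in terms of the dimension, `max
|φ|`, the two volumes, `τ`, and a `d` for which balls of radius `d` about points of `Ω₀` lie in `Ω`.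

All of this needs `u` to be `C³` inside `Ω`, which is the interior Morrey embedding
(`MemSobolev.contDiffOn`). It is proved by following the mollifications of a Sobolev function as the
scale varies: their derivative in the scale `t` is of size `t^(-n/s)`, which is integrable at `0`
because `s > n`. -/

/-! ### Mollification and its derivatives in space and in scale. -/

/-- A smooth probability density supported in the ball of radius `2`. -/
def unitBump (n : ℕ) : ContDiffBump (0 : E n) := ⟨1, 2, one_pos, one_lt_two⟩

/-- The mollification kernel at scale `t`. -/
def mollKernel (n : ℕ) (t : ℝ) (y : E n) : ℝ :=
  t⁻¹ ^ n * (unitBump n).normed volume (t⁻¹ • y)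

/-- Mollification at scale `t`. -/
def mollify (t : ℝ) (g : E n → ℝ) : E n → ℝ :=
  mollKernel n t ⋆[lsmul ℝ ℝ, volume] g

/-- The two descriptions serve different ends: the explicit scaling can be differentiated in `t`,
while the normalized bump supplies total mass one, the support and the convergence theorems. -/
lemma mollKernel_eq_normed {t : ℝ} (ht : 0 < t) :
    mollKernel n t =
      (⟨t, 2 * t, ht, by linarith⟩ : ContDiffBump (0 : E n)).normed volume := by
  have key : ∀ x : E n, (⟨t, 2 * t, ht, by linarith⟩ : ContDiffBump (0 : E n)) x
      = unitBump n (t⁻¹ • x) := by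
    intro x
    simp only [ContDiffBump.apply, unitBump, sub_zero, inv_one, one_smul]
    rw [mul_div_assoc, div_self ht.ne', mul_one, div_one]
  ext y
  simp only [mollKernel, ContDiffBump.normed_def, key]
  rw [Measure.integral_comp_smul volume (fun x => unitBump n x) t⁻¹]
  simp only [finrank_euclideanSpace, Fintype.card_fin, smul_eq_mul]
  rw [abs_of_pos (by positivity)]
  have := (unitBump n).integral_pos (μ := volume)
  field_simp

lemma contDiff_mollKernel (t : ℝ) : ContDiff ℝ ∞ (mollKernel n t) := by
  unfold mollKernel
  have : ContDiff ℝ ∞ ((unitBump n).normed volume) := (unitBump n).contDiff_normed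
  fun_prop

lemma support_mollKernel {t : ℝ} (ht : 0 < t) :
    Function.support (mollKernel n t) = Metric.ball 0 (2 * t) := by
  rw [mollKernel_eq_normed ht, ContDiffBump.support_normed_eq]

lemma hasCompactSupport_mollKernel {t : ℝ} (ht : 0 < t) :
    HasCompactSupport (mollKernel n t) := by
  rw [mollKernel_eq_normed ht]; exact ContDiffBump.hasCompactSupport_normed _

lemma mollify_apply (t : ℝ) (g : E n → ℝ) (x : E n) :
    mollify t g x = ∫ z, mollKernel n t (x - z) * g z := by
  simp [mollify, convolution_eq_swap]

lemma dist_mollify_le {t : ℝ} (ht : 0 < t) {g : E n → ℝ} (hg : AEStronglyMeasurable g volume)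
    {x : E n} {δ : ℝ} (h : ∀ y ∈ Metric.ball x (2 * t), dist (g y) (g x) ≤ δ) :
    dist (mollify t g x) (g x) ≤ δ := by
  unfold mollify
  rw [mollKernel_eq_normed ht]
  exact ContDiffBump.dist_normed_convolution_le hg h

lemma contDiff_mollify {t : ℝ} (ht : 0 < t) {g : E n → ℝ} (hg : LocallyIntegrable g volume) :
    ContDiff ℝ ∞ (mollify t g) :=
  (hasCompactSupport_mollKernel ht).contDiff_convolution_left _ (contDiff_mollKernel t) hg

lemma ae_tendsto_mollify {g : E n → ℝ} (hg : LocallyIntegrable g volume) :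
    ∀ᵐ x, Tendsto (fun k : ℕ => mollify ((1 / 2 : ℝ) ^ k) g x) atTop (𝓝 (g x)) := by
  have hp : ∀ k : ℕ, (0 : ℝ) < (1 / 2) ^ k := fun k => by positivity
  have hlim : Tendsto (fun k : ℕ => 2 * (1 / 2 : ℝ) ^ k) atTop (𝓝 0) := by
    simpa using (tendsto_pow_atTop_nhds_zero_of_lt_one (r := (1 / 2 : ℝ)) (by norm_num)
      (by norm_num)).const_mul 2
  have := ContDiffBump.ae_convolution_tendsto_right_of_locallyIntegrable (μ := volume) (K := 2)
    (φ := fun k : ℕ => (⟨(1 / 2) ^ k, 2 * (1 / 2) ^ k, hp k, by linarith [hp k]⟩ :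
      ContDiffBump (0 : E n))) (l := atTop) hlim (Eventually.of_forall fun k => le_rfl) hg
  filter_upwards [this] with x hx
  simpa only [mollify, mollKernel_eq_normed (hp _)] using hx

lemma fderiv_apply_eq_sum_pd (f : E n → ℝ) (x y : E n) :
    fderiv ℝ f x y = ∑ i, y i * pd i f x := by
  conv_lhs => rw [← (EuclideanSpace.basisFun (Fin n) ℝ).sum_repr y, map_sum]
  simp [pd, basisVec]

lemma tsupport_mollKernel_sub_subset {t : ℝ} (ht : 0 < t) (x : E n) :
    tsupport (fun z => mollKernel n t (x - z)) ⊆ Metric.closedBall x (2 * t) := by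
  refine closure_minimal ?_ Metric.isClosed_closedBall
  intro z hz
  have : x - z ∈ Function.support (mollKernel n t) := hz
  rw [support_mollKernel ht, mem_ball_zero_iff] at this
  rw [Metric.mem_closedBall, dist_comm, dist_eq_norm]; exact this.le

lemma pd_comp_sub_left {f : E n → ℝ} (hf : Differentiable ℝ f) (i : Fin n) (x z : E n) :
    pd i (fun z => f (x - z)) z = - pd i f (x - z) := by
  have := (hf (x - z)).hasFDerivAt.comp z ((hasFDerivAt_id z).const_sub x)
  have h' : fderiv ℝ (fun z => f (x - z)) z = _ := this.fderiv
  simp [pd, h']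

lemma integral_indicator_right {Ω : Set (E n)} (hΩ : MeasurableSet Ω) (a g : E n → ℝ) :
    ∫ z, a z * Ω.indicator g z = ∫ z in Ω, a z * g z := by
  rw [← integral_indicator hΩ]; congr 1; ext z; by_cases hz : z ∈ Ω <;> simp [hz]

/-- As the ball lies in `Ω`, the translated reflected kernel `z ↦ K(x - z)` is itself an admissible
test function. The sign in the weak formulation cancels the one from differentiating in `x - z`. -/
lemma pd_mollify {Ω : Set (E n)} (hΩ : IsOpen Ω) {g v : E n → ℝ} {i : Fin n}
    (h : HasWeakPartialDeriv Ω i g v) (hg : IntegrableOn g Ω)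
    {t : ℝ} (ht : 0 < t) {x : E n} (hx : Metric.closedBall x (2 * t) ⊆ Ω) :
    pd i (mollify t (Ω.indicator g)) x = mollify t (Ω.indicator v) x := by
  have hg' : LocallyIntegrable (Ω.indicator g) volume :=
    (hg.integrable_indicator hΩ.measurableSet).locallyIntegrable
  have h1 := (hasCompactSupport_mollKernel (n := n) ht).hasFDerivAt_convolution_left
    (lsmul ℝ ℝ) ((contDiff_mollKernel t).of_le (by simp)) hg' x
  have hη : ContDiff ℝ ∞ (fun z => mollKernel n t (x - z)) :=
    (contDiff_mollKernel t).comp (by fun_prop)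
  have hsupp := tsupport_mollKernel_sub_subset ht x
  have hc : HasCompactSupport (fun z => mollKernel n t (x - z)) :=
    HasCompactSupport.of_support_subset_isCompact (isCompact_closedBall x (2 * t))
      ((subset_tsupport _).trans hsupp)
  have h2 := h.integral_eq _ hη hc (hsupp.trans hx)
  rw [mollify_apply, integral_indicator_right hΩ.measurableSet]
  simp only [pd_comp_sub_left ((contDiff_mollKernel t).differentiable (by simp))] at h2
  have h3 : pd i (mollify t (Ω.indicator g)) x
      = ∫ z, pd i (mollKernel n t) (x - z) * Ω.indicator g z := by
    unfold pd
    rw [mollify, h1.fderiv, convolution_eq_swap, ContinuousLinearMap.integral_apply]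
    · rfl
    · exact (((hasCompactSupport_mollKernel ht).fderiv ℝ).convolutionExists_left _
        ((contDiff_mollKernel t).continuous_fderiv (by simp)) hg' x).integrable_swap
  rw [h3, integral_indicator_right hΩ.measurableSet]
  have h4 : ∫ z in Ω, g z * -pd i (mollKernel n t) (x - z)
     = - ∫ z in Ω, pd i (mollKernel n t) (x - z) * g z := by
    rw [← integral_neg]; congr 1; ext z; ring
  rw [h4, neg_inj] at h2
  rw [h2]; congr 1; ext z; ring

/-- The derivative of the mollification kernel in the scale. -/
def mollKernelDeriv (n : ℕ) (t : ℝ) (y : E n) : ℝ :=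
  -t⁻¹ * (n * mollKernel n t y + fderiv ℝ (mollKernel n t) y y)

lemma contDiff_unitBump_normed : ContDiff ℝ ∞ ((unitBump n).normed volume) :=
  (unitBump n).contDiff_normed

/-- The radial derivative scales like the kernel itself, so it is bounded by a constant times
`t^(-n)` uniformly in `y`. -/
lemma fderiv_mollKernel_apply_self (t : ℝ) (y : E n) :
    fderiv ℝ (mollKernel n t) y y =
      t⁻¹ ^ n * fderiv ℝ ((unitBump n).normed volume) (t⁻¹ • y) (t⁻¹ • y) := by
  have hd : DifferentiableAt ℝ ((unitBump n).normed volume) (t⁻¹ • y) :=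
    contDiff_unitBump_normed.differentiable (by simp) _
  have h1 := (hd.hasFDerivAt.comp y ((hasFDerivAt_id y).const_smul t⁻¹)).const_mul (t⁻¹ ^ n)
  have h2 : fderiv ℝ (mollKernel n t) y = _ := h1.fderiv
  rw [h2]; simp

lemma hasDerivAt_mollKernel {t : ℝ} (ht : 0 < t) (y : E n) :
    HasDerivAt (fun t => mollKernel n t y) (mollKernelDeriv n t y) t := by
  have hd : DifferentiableAt ℝ ((unitBump n).normed volume) (t⁻¹ • y) :=
    contDiff_unitBump_normed.differentiable (by simp) _
  have h0 := hasDerivAt_inv ht.ne'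
  have h1 := hd.hasFDerivAt.comp_hasDerivAt t (h0.smul_const y)
  have h2 := (h0.pow n).mul h1
  refine h2.congr_deriv ?_
  rw [mollKernelDeriv, fderiv_mollKernel_apply_self, mollKernel]
  simp only [Function.comp_apply, map_smul, smul_eq_mul, Pi.pow_apply]
  -- The derivative of `t⁻¹ ^ n` carries the truncated exponent `n - 1`, hence the split.
  rcases n with _ | n
  · simp; ring
  · simp; ring

lemma exists_unitBump_bound (n : ℕ) : ∃ C, 0 < C ∧
    (∀ y : E n, |(unitBump n).normed volume y| ≤ C) ∧
    ∀ y : E n, |fderiv ℝ ((unitBump n).normed volume) y y| ≤ C := by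
  have hc := (unitBump n).hasCompactSupport_normed (μ := volume)
  obtain ⟨C₁, h₁⟩ := (contDiff_unitBump_normed (n := n)).continuous.bounded_above_of_compact_support hc
  have hcont : Continuous fun y : E n => fderiv ℝ ((unitBump n).normed volume) y y :=
    ((contDiff_unitBump_normed (n := n)).continuous_fderiv (by simp)).clm_apply continuous_id
  have hc' : HasCompactSupport fun y : E n => fderiv ℝ ((unitBump n).normed volume) y y :=
    (hc.fderiv ℝ).mono fun y hy h0 => hy (by simp [h0])
  obtain ⟨C₂, h₂⟩ := hcont.bounded_above_of_compact_support hc'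
  refine ⟨max (max C₁ C₂) 1, by positivity, fun y => (h₁ y).trans (by simp), fun y =>
    (h₂ y).trans (by simp)⟩

lemma continuous_mollKernelDeriv (t : ℝ) : Continuous (mollKernelDeriv n t) := by
  unfold mollKernelDeriv
  have h1 := (contDiff_mollKernel (n := n) t).continuous
  have h2 := ((contDiff_mollKernel (n := n) t).continuous_fderiv (by simp)).clm_apply continuous_id
  simp only [id] at h2
  fun_prop

lemma abs_mollKernelDeriv_le {C : ℝ} (h₁ : ∀ y : E n, |(unitBump n).normed volume y| ≤ C)
    (h₂ : ∀ y : E n, |fderiv ℝ ((unitBump n).normed volume) y y| ≤ C) {t : ℝ} (ht : 0 < t)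
    (y : E n) : |mollKernelDeriv n t y| ≤ t⁻¹ * (n * (t⁻¹ ^ n * C) + t⁻¹ ^ n * C) := by
  rw [mollKernelDeriv, fderiv_mollKernel_apply_self, mollKernel, abs_mul, abs_neg,
    abs_of_pos (inv_pos.2 ht)]
  gcongr
  refine (abs_add_le _ _).trans ?_
  rw [abs_mul, abs_mul, abs_mul, abs_of_pos (pow_pos (inv_pos.2 ht) n), Nat.abs_cast]
  gcongr
  · exact h₁ _
  · exact h₂ _

lemma hasDerivAt_mollify {g : E n → ℝ} (hg : Integrable g volume) (x : E n) {t : ℝ} (ht : 0 < t) :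
    HasDerivAt (fun t => mollify t g x) (∫ z, mollKernelDeriv n t (x - z) * g z) t := by
  obtain ⟨C, hC, h₁, h₂⟩ := exists_unitBump_bound n
  simp only [mollify_apply]
  have hmeas : ∀ f : E n → ℝ, Continuous f → AEStronglyMeasurable (fun z => f (x - z) * g z)
      volume := fun f hf => (hf.comp (by fun_prop)).aestronglyMeasurable.mul hg.1
  -- Scales stay above `t / 2`, and the kernel bound decreases in the scale, so its value at `t / 2`
  -- dominates.
  refine (hasDerivAt_integral_of_dominated_loc_of_deriv_le (s := Ioi (t / 2))
    (F := fun t z => mollKernel n t (x - z) * g z)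
    (F' := fun t z => mollKernelDeriv n t (x - z) * g z)
    (bound := fun z => ((t/2)⁻¹ * (n * ((t/2)⁻¹ ^ n * C) + (t/2)⁻¹ ^ n * C)) * |g z|)
    (Ioi_mem_nhds (by linarith)) ?_ ?_ ?_ ?_ ?_ ?_).2
  · exact Eventually.of_forall fun s => hmeas _ (contDiff_mollKernel s).continuous
  · have hk := (contDiff_mollKernel (n := n) t).continuous
    refine hg.bdd_mul (c := t⁻¹ ^ n * C) ((hk.comp (by fun_prop)).aestronglyMeasurable) ?_
    refine Eventually.of_forall fun z => ?_
    rw [Real.norm_eq_abs, mollKernel, abs_mul, abs_of_pos (pow_pos (inv_pos.2 ht) n)]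
    gcongr
    exact h₁ _
  · exact hmeas _ (continuous_mollKernelDeriv t)
  · refine Eventually.of_forall fun z s hs => ?_
    have hs' : t / 2 < s := hs
    have hs0 : 0 < s := by linarith
    rw [norm_mul, Real.norm_eq_abs, Real.norm_eq_abs]
    gcongr
    refine (abs_mollKernelDeriv_le h₁ h₂ hs0 _).trans ?_
    gcongr
  · exact hg.abs.const_mul _
  · refine Eventually.of_forall fun z s hs => ?_
    have hs' : t / 2 < s := hs
    exact (hasDerivAt_mollKernel (by linarith) _).mul_const _

/-- The vector field whose divergence is the scale derivative of the mollification kernel. -/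
def mollField (t : ℝ) (x : E n) (i : Fin n) (z : E n) : ℝ :=
  t⁻¹ * ((x - z) i * mollKernel n t (x - z))

lemma contDiff_mollField (t : ℝ) (x : E n) (i : Fin n) : ContDiff ℝ ∞ (mollField t x i) := by
  unfold mollField
  have h1 : ContDiff ℝ ∞ (fun z : E n => mollKernel n t (x - z)) :=
    (contDiff_mollKernel t).comp (by fun_prop)
  have h2 : ContDiff ℝ ∞ (fun z : E n => (x - z) i) := by
    have : ContDiff ℝ ∞ (fun z : E n => z i) := contDiff_piLp_apply 2
    simpa using contDiff_const.sub this
  exact contDiff_const.mul (h2.mul h1)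

lemma pd_mollField (t : ℝ) (x : E n) (i : Fin n) (z : E n) : pd i (mollField t x i) z
    = - t⁻¹ * (mollKernel n t (x - z) + (x - z) i * pd i (mollKernel n t) (x - z)) := by
  have h1 : Differentiable ℝ (fun z : E n => mollKernel n t (x - z)) :=
    ((contDiff_mollKernel t).comp (by fun_prop)).differentiable (by simp : (∞ : WithTop ℕ∞) ≠ 0)
  have h2 : HasFDerivAt (fun z : E n => (x - z) i) (-(EuclideanSpace.proj i : E n →L[ℝ] ℝ)) z := by
    have := (EuclideanSpace.proj i : E n →L[ℝ] ℝ).hasFDerivAt (x := z)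
    simpa using this.const_sub (x i)
  have h3 : fderiv ℝ (mollField t x i) z = _ := ((h2.mul (h1 z).hasFDerivAt).const_mul t⁻¹).fderiv
  have h4 := pd_comp_sub_left ((contDiff_mollKernel (n := n) t).differentiable (by simp)) i x z
  simp only [pd, basisVec] at h4 ⊢
  rw [h3]
  simp [h4]
  ring

/-- With `y = x - z`, both sides equal `-t⁻¹ (n K(y) + DK(y) y)`. Being a divergence, the scale
derivative of the kernel can be integrated by parts against a Sobolev function. -/
lemma sum_pd_mollField (t : ℝ) (x z : E n) :
    ∑ i, pd i (mollField t x i) z = mollKernelDeriv n t (x - z) := by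
  simp only [pd_mollField, mollKernelDeriv, fderiv_apply_eq_sum_pd]
  rw [← Finset.mul_sum, Finset.sum_add_distrib]
  simp

lemma support_mollField_subset {t : ℝ} (ht : 0 < t) (x : E n) (i : Fin n) :
    Function.support (mollField t x i) ⊆ Metric.ball x (2 * t) := by
  intro z hz
  have : x - z ∈ Function.support (mollKernel n t) := fun h => hz (by simp [mollField, h])
  rw [support_mollKernel ht, mem_ball_zero_iff] at this
  rw [Metric.mem_ball, dist_comm, dist_eq_norm]; exact this

/-- On the support `|x - z| < 2t`, which absorbs the factor `t⁻¹`. -/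
lemma abs_mollField_le {C : ℝ} (h₁ : ∀ y : E n, |(unitBump n).normed volume y| ≤ C)
    {t : ℝ} (ht : 0 < t) (x : E n) (i : Fin n) (z : E n) :
    |mollField t x i z| ≤ 2 * (t⁻¹ ^ n * C) := by
  have hC : 0 ≤ C := (abs_nonneg _).trans (h₁ 0)
  by_cases hz : z ∈ Function.support (mollField t x i)
  · have hz' := support_mollField_subset ht x i hz
    rw [Metric.mem_ball, dist_comm, dist_eq_norm] at hz'
    have h2 : |(x - z) i| ≤ 2 * t := (PiLp.norm_apply_le (x - z) i).trans hz'.le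
    rw [mollField, mollKernel, abs_mul, abs_mul, abs_mul, abs_of_pos (inv_pos.2 ht),
      abs_of_pos (pow_pos (inv_pos.2 ht) n)]
    calc _ ≤ t⁻¹ * (2 * t * (t⁻¹ ^ n * C)) := by
          gcongr
          exact h₁ _
      _ = _ := by field_simp
  · rw [Function.notMem_support.1 hz, abs_zero]; positivity

/-! ### Interior Morrey and Sobolev embeddings. -/

lemma setIntegral_abs_le_eLpNorm {Ω B : Set (E n)} (hB : B ⊆ Ω) (hB' : volume B ≠ ⊤)
    {v : E n → ℝ} {s : ℝ} (hs : 1 ≤ s)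
    (hv : MemLp v (ENNReal.ofReal s) (volume.restrict Ω)) :
    ∫ z in B, |v z| ≤ (eLpNorm v (ENNReal.ofReal s) (volume.restrict Ω)).toReal
      * volume.real B ^ (1 - 1 / s) := by
  have hvB : MemLp v (ENNReal.ofReal s) (volume.restrict B) :=
    hv.mono_measure (Measure.restrict_mono hB le_rfl)
  have h1 : ∫ z in B, |v z| = (eLpNorm v 1 (volume.restrict B)).toReal := by
    rw [eLpNorm_one_eq_lintegral_enorm, ← integral_norm_eq_lintegral_enorm hvB.1]
    simp
  have hs' : (1 : ℝ≥0∞) ≤ ENNReal.ofReal s := by simpa using ENNReal.ofReal_le_ofReal hs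
  have h2 := eLpNorm_le_eLpNorm_mul_rpow_measure_univ hs' hvB.1
  rw [Measure.restrict_apply_univ, ENNReal.toReal_one, ENNReal.toReal_ofReal (by linarith),
    div_one] at h2
  have h3 : eLpNorm v (ENNReal.ofReal s) (volume.restrict B)
      ≤ eLpNorm v (ENNReal.ofReal s) (volume.restrict Ω) :=
    eLpNorm_mono_measure _ (Measure.restrict_mono hB le_rfl)
  have hexp : 0 ≤ 1 - 1 / s := by
    rw [sub_nonneg, div_le_one (by linarith)]; exact hs
  rw [h1, Measure.real, ENNReal.toReal_rpow, ← ENNReal.toReal_mul]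
  refine ENNReal.toReal_mono ?_ (h2.trans (by gcongr))
  exact ENNReal.mul_ne_top hv.2.ne (ENNReal.rpow_ne_top_of_nonneg hexp hB')

lemma hasDerivAt_mollify_weak {Ω : Set (E n)} (hΩ : IsOpen Ω) {g : E n → ℝ} {v : Fin n → E n → ℝ}
    (h : ∀ i, HasWeakPartialDeriv Ω i g (v i)) (hg : IntegrableOn g Ω)
    {t : ℝ} (ht : 0 < t) {x : E n} (hx : Metric.closedBall x (2 * t) ⊆ Ω) :
    HasDerivAt (fun t => mollify t (Ω.indicator g) x)
      (-∑ i, ∫ z in Ω, v i z * mollField t x i z) t := by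
  refine (hasDerivAt_mollify (hg.integrable_indicator hΩ.measurableSet) x ht).congr_deriv ?_
  rw [integral_indicator_right hΩ.measurableSet]
  simp only [← sum_pd_mollField, Finset.sum_mul]
  have hsupp : ∀ i, tsupport (mollField t x i) ⊆ Metric.closedBall x (2 * t) := fun i =>
    closure_minimal ((support_mollField_subset ht x i).trans Metric.ball_subset_closedBall)
      Metric.isClosed_closedBall
  have hc : ∀ i, HasCompactSupport (mollField t x i) := fun i =>
    HasCompactSupport.of_support_subset_isCompact (isCompact_closedBall x (2 * t))
      ((subset_tsupport _).trans (hsupp i))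
  rw [integral_finsetSum, ← Finset.sum_neg_distrib]
  · refine Finset.sum_congr rfl fun i _ => ?_
    rw [← (h i).integral_eq _ (contDiff_mollField t x i) (hc i) ((hsupp i).trans hx)]
    congr 1; ext z; ring
  · intro i _
    have hcont : Continuous (pd i (mollField t x i)) :=
      ((contDiff_mollField t x i).continuous_fderiv (by simp)).clm_apply continuous_const
    obtain ⟨C, hC⟩ := hcont.bounded_above_of_compact_support ((hc i).fderiv_apply ℝ _)
    exact hg.bdd_mul hcont.aestronglyMeasurable (Eventually.of_forall hC)

/-- The field has size `t^(-n)` on a ball of radius `2t`, and Hölder bounds the integral of `|v i|`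
there by a multiple of `t^(n(1 - 1/s))`. The exponents add up to `-n/s`. -/
lemma exists_bound_integral_mollField {Ω : Set (E n)} (hΩ : IsOpen Ω) {v : Fin n → E n → ℝ} {s : ℝ} (hs : 1 ≤ s)
    (hv : ∀ i, MemLp (v i) (ENNReal.ofReal s) (volume.restrict Ω)) :
    ∃ D, 0 < D ∧ ∀ (x : E n) (t : ℝ), 0 < t → Metric.closedBall x (2 * t) ⊆ Ω →
      |∑ i, ∫ z in Ω, v i z * mollField t x i z| ≤ D * t ^ (-(n / s) : ℝ) := by
  obtain ⟨C, hC, h₁, -⟩ := exists_unitBump_bound n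
  set N : Fin n → ℝ := fun i => (eLpNorm (v i) (ENNReal.ofReal s) (volume.restrict Ω)).toReal
  set κ : ℝ := volume.real (Metric.ball (0 : E n) 1)
  refine ⟨∑ i, 2 * C * (N i * (2 ^ n * κ) ^ (1 - 1 / s)) + 1, by positivity, fun x t ht hx => ?_⟩
  rw [add_mul, Finset.sum_mul]
  refine (Finset.abs_sum_le_sum_abs _ _).trans
    ((Finset.sum_le_sum fun i _ => ?_).trans (le_add_of_nonneg_right (by positivity)))
  have hball : Metric.ball x (2 * t) ⊆ Ω := Metric.ball_subset_closedBall.trans hx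
  have e1 : ∫ z in Ω, v i z * mollField t x i z
      = ∫ z in Metric.ball x (2 * t), v i z * mollField t x i z := by
    refine setIntegral_eq_of_subset_of_forall_sdiff_eq_zero hΩ.measurableSet hball fun z hz => ?_
    rw [Function.notMem_support.1 fun h => hz.2 (support_mollField_subset ht x i h), mul_zero]
  have e2 : |∫ z in Metric.ball x (2 * t), v i z * mollField t x i z|
      ≤ ∫ z in Metric.ball x (2 * t), 2 * (t⁻¹ ^ n * C) * |v i z| := by
    rw [← Real.norm_eq_abs]
    refine norm_integral_le_of_norm_le ?_ (Eventually.of_forall fun z => ?_)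
    · have hvi : MemLp (v i) (ENNReal.ofReal s) (volume.restrict (Metric.ball x (2 * t))) :=
        (hv i).mono_measure (Measure.restrict_mono hball le_rfl)
      have hs' : (1 : ℝ≥0∞) ≤ ENNReal.ofReal s := by simpa using ENNReal.ofReal_le_ofReal hs
      have : IsFiniteMeasure (volume.restrict (Metric.ball x (2 * t))) :=
        ⟨by simpa using measure_ball_lt_top⟩
      exact ((hvi.integrable hs').abs).const_mul _
    · rw [norm_mul, mul_comm]
      gcongr
      · exact abs_mollField_le h₁ ht x i z
      · exact le_rfl
  rw [e1]
  refine e2.trans ?_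
  rw [integral_const_mul]
  have e3 := setIntegral_abs_le_eLpNorm hball measure_ball_lt_top.ne hs (hv i)
  have e4 : volume.real (Metric.ball x (2 * t)) = t ^ (n : ℝ) * (2 ^ n * κ) := by
    rw [Measure.real, Measure.addHaar_ball_of_pos volume x (by positivity), ENNReal.toReal_mul, ENNReal.toReal_ofReal (by positivity), finrank_euclideanSpace,
      Fintype.card_fin, mul_pow, Real.rpow_natCast, ← Measure.real]
    ring
  rw [e4, Real.mul_rpow (by positivity) (by positivity), ← Real.rpow_mul ht.le] at e3
  have e5 : t⁻¹ ^ n * t ^ ((n : ℝ) * (1 - 1 / s)) = t ^ (-(n / s) : ℝ) := by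
    rw [inv_pow, ← Real.rpow_natCast, ← Real.rpow_neg ht.le, ← Real.rpow_add ht]
    congr 1; ring
  calc _ ≤ 2 * (t⁻¹ ^ n * C) * (N i * (t ^ ((n : ℝ) * (1 - 1 / s)) * (2 ^ n * κ) ^ (1 - 1 / s))) := by
        gcongr
    _ = 2 * C * (N i * (2 ^ n * κ) ^ (1 - 1 / s)) * (t⁻¹ ^ n * t ^ ((n : ℝ) * (1 - 1 / s))) := by
        ring
    _ = _ := by rw [e5]

/-- The mollifications of a Sobolev function with integrability above the dimension are uniformly
Cauchy. -/
lemma exists_mollify_cauchy_bound {Ω : Set (E n)} (hΩ : IsOpen Ω) {g : E n → ℝ}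
    {v : Fin n → E n → ℝ} {s : ℝ} (hs : 1 ≤ s) (hns : n < s)
    (h : ∀ i, HasWeakPartialDeriv Ω i g (v i)) (hg : IntegrableOn g Ω)
    (hv : ∀ i, MemLp (v i) (ENNReal.ofReal s) (volume.restrict Ω)) :
    ∃ D, 0 < D ∧ ∀ (x : E n) (t t' : ℝ), 0 < t' → t' ≤ t → Metric.closedBall x (2 * t) ⊆ Ω →
      |mollify t (Ω.indicator g) x - mollify t' (Ω.indicator g) x| ≤ D * t ^ (1 - n / s : ℝ) := by
  obtain ⟨D, hD, hb⟩ := exists_bound_integral_mollField hΩ hs hv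
  have hα : 0 < 1 - (n : ℝ) / s := by
    rw [sub_pos, div_lt_one (by linarith)]; exact hns
  refine ⟨D / (1 - n / s), by positivity, fun x t t' ht' htt hx => ?_⟩
  set p : ℝ → ℝ := fun r => mollify r (Ω.indicator g) x
  -- A primitive of the bound `D r^(-n/s)`; it is nonnegative for `r > 0` because `n < s`.
  set q : ℝ → ℝ := fun r => D / (1 - n / s) * r ^ (1 - n / s : ℝ)
  have hq : ∀ r, 0 < r → HasDerivAt q (D * r ^ (-(n / s) : ℝ)) r := by
    intro r hr
    refine ((Real.hasDerivAt_rpow_const (p := (1 - n / s : ℝ)) (Or.inl hr.ne')).const_mul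
      (D / (1 - n / s))).congr_deriv ?_
    rw [show (1 - n / s - 1 : ℝ) = -(n / s) by ring, ← mul_assoc, div_mul_cancel₀ _ hα.ne']
  have hp : ∀ r ∈ Icc t' t, HasDerivAt p (-∑ i, ∫ z in Ω, v i z * mollField r x i z) r ∧
      |-∑ i, ∫ z in Ω, v i z * mollField r x i z| ≤ D * r ^ (-(n / s) : ℝ) := by
    intro r hr
    have hr0 : 0 < r := ht'.trans_le hr.1
    have hxr : Metric.closedBall x (2 * r) ⊆ Ω :=
      (Metric.closedBall_subset_closedBall (by linarith [hr.2])).trans hx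
    exact ⟨hasDerivAt_mollify_weak hΩ h hg hr0 hxr, by rw [abs_neg]; exact hb x r hr0 hxr⟩
  -- Monotonicity of `q - σ p` for both signs replaces integrating `p'`, whose integrability in `r`
  -- then never has to be shown.
  have mono : ∀ σ : ℝ, |σ| = 1 → q t' - σ * p t' ≤ q t - σ * p t := by
    intro σ hσ
    have hd : ∀ r ∈ Icc t' t, HasDerivAt (fun r => q r - σ * p r)
        (D * r ^ (-(n / s) : ℝ) - σ * (-∑ i, ∫ z in Ω, v i z * mollField r x i z)) r :=
      fun r hr => (hq r (ht'.trans_le hr.1)).sub ((hp r hr).1.const_mul σ)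
    refine monotoneOn_of_deriv_nonneg (convex_Icc t' t)
      (fun r hr => (hd r hr).continuousAt.continuousWithinAt)
      (fun r hr => (hd r (interior_subset hr)).differentiableAt.differentiableWithinAt)
      (fun r hr => ?_) (left_mem_Icc.2 htt) (right_mem_Icc.2 htt) htt
    rw [(hd r (interior_subset hr)).deriv, sub_nonneg]
    refine (le_abs_self _).trans ?_
    rw [abs_mul, hσ, one_mul]
    exact (hp r (interior_subset hr)).2
  have h1 := mono 1 (by simp)
  have h2 := mono (-1) (by simp)
  have h3 : 0 ≤ q t' := by positivity
  rw [abs_le]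
  constructor <;> simp only [p, q] at * <;> linarith

/-- Morrey's embedding, in the interior: a Sobolev function with integrability above the dimension
has a continuous representative. -/
lemma exists_continuousOn_ae_eq {Ω : Set (E n)} (hΩ : IsOpen Ω) {g : E n → ℝ}
    {v : Fin n → E n → ℝ} {s : ℝ} (hs : 1 ≤ s) (hns : n < s)
    (h : ∀ i, HasWeakPartialDeriv Ω i g (v i)) (hg : IntegrableOn g Ω)
    (hv : ∀ i, MemLp (v i) (ENNReal.ofReal s) (volume.restrict Ω)) :
    ∃ g' : E n → ℝ, ContinuousOn g' Ω ∧ g =ᵐ[volume.restrict Ω] g' := by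
  obtain ⟨D, hD, hb⟩ := exists_mollify_cauchy_bound hΩ hs hns h hg hv
  have hα : 0 < 1 - (n : ℝ) / s := by
    rw [sub_pos, div_lt_one (by linarith)]; exact hns
  set τ : ℕ → ℝ := fun k => (1 / 2 : ℝ) ^ k with hτ
  have hτ0 : ∀ k, 0 < τ k := fun k => by positivity
  have hτanti : Antitone τ := fun a b hab => pow_le_pow_of_le_one (by norm_num) (by norm_num) hab
  have hτlim : Tendsto τ atTop (𝓝 0) :=
    tendsto_pow_atTop_nhds_zero_of_lt_one (by norm_num) (by norm_num)
  set p : ℕ → E n → ℝ := fun k => mollify (τ k) (Ω.indicator g)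
  have hgi := (hg.integrable_indicator hΩ.measurableSet).locallyIntegrable
  have hrate : Tendsto (fun k => D * τ k ^ (1 - n / s : ℝ)) atTop (𝓝 0) := by
    have := (hτlim.rpow_const (p := 1 - n / s) (Or.inr hα.le)).const_mul D
    rwa [Real.zero_rpow hα.ne', mul_zero] at this
  have hball : ∀ x ∈ Ω, ∃ k₀ : ℕ, ∃ r > 0, ∀ y ∈ Metric.ball x r, ∀ k ≥ k₀,
      Metric.closedBall y (2 * τ k) ⊆ Ω := by
    intro x hx
    obtain ⟨r, hr, hrΩ⟩ := Metric.isOpen_iff.1 hΩ x hx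
    obtain ⟨k₀, hk₀⟩ := (hτlim.eventually (gt_mem_nhds (show 0 < r / 4 by positivity))).exists
    refine ⟨k₀, r / 2, by positivity, fun y hy k hk => ?_⟩
    refine Subset.trans (fun z hz => ?_) hrΩ
    have h1 := hτanti hk
    rw [Metric.mem_closedBall] at hz
    rw [Metric.mem_ball] at hy ⊢
    have := dist_triangle z y x
    linarith
  have hconv : ∀ x ∈ Ω, ∃ l, Tendsto (fun k => p k x) atTop (𝓝 l) := by
    intro x hx
    obtain ⟨k₀, r, hr, hk⟩ := hball x hx
    refine cauchySeq_tendsto_of_complete (Metric.cauchySeq_iff'.2 fun δ hδ => ?_)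
    obtain ⟨N, hN₀, hN⟩ := ((eventually_ge_atTop k₀).and
      (hrate.eventually (gt_mem_nhds hδ))).exists
    refine ⟨N, fun j hj => ?_⟩
    rw [dist_comm, Real.dist_eq]
    exact (hb x _ _ (hτ0 j) (hτanti hj) (hk x (Metric.mem_ball_self hr) N hN₀)).trans_lt hN
  choose! g' hg' using hconv
  refine ⟨g', ?_, ?_⟩
  · have hloc : TendstoLocallyUniformlyOn p g' atTop Ω := by
      rw [Metric.tendstoLocallyUniformlyOn_iff]
      intro δ hδ x hx
      obtain ⟨k₀, r, hr, hk⟩ := hball x hx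
      refine ⟨Metric.ball x r ∩ Ω, ?_, ?_⟩
      · exact inter_mem (mem_nhdsWithin_of_mem_nhds (Metric.ball_mem_nhds x hr))
          self_mem_nhdsWithin
      · filter_upwards [hrate.eventually (gt_mem_nhds (half_pos hδ)), eventually_ge_atTop k₀]
          with k hk1 hk2 y hy
        have hlim := ((tendsto_const_nhds (x := p k y)).sub (hg' y hy.2)).abs
        have hle : |p k y - g' y| ≤ D * τ k ^ (1 - n / s : ℝ) := by
          refine le_of_tendsto hlim ?_
          filter_upwards [eventually_ge_atTop k] with j hj
          exact hb y _ _ (hτ0 j) (hτanti hj) (hk y hy.1 k hk2)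
        rw [dist_comm, Real.dist_eq]
        linarith
    exact hloc.continuousOn (Eventually.of_forall fun k =>
      (contDiff_mollify (hτ0 k) hgi).continuous.continuousOn).frequently
  -- Almost every point is a point where the mollifications converge to `g`, so the uniform limit
  -- agrees with `g` there.
  · have := ae_tendsto_mollify hgi
    rw [EventuallyEq, ae_restrict_iff' hΩ.measurableSet]
    filter_upwards [this] with x hx hxΩ
    rw [indicator_of_mem hxΩ] at hx
    exact tendsto_nhds_unique hx (hg' x hxΩ)

lemma exists_ball_tendstoUniformlyOn_mollify {Ω : Set (E n)} (hΩ : IsOpen Ω) {h : E n → ℝ}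
    (hh : ContinuousOn h Ω) {x : E n} {r : ℝ} (hr : 0 < r) (hx : Metric.closedBall x (2 * r) ⊆ Ω) :
    TendstoUniformlyOn (fun k : ℕ => mollify ((1 / 2 : ℝ) ^ k) (Ω.indicator h)) h atTop
      (Metric.ball x r) := by
  have hlim : Tendsto (fun k : ℕ => (1 / 2 : ℝ) ^ k) atTop (𝓝 0) :=
    tendsto_pow_atTop_nhds_zero_of_lt_one (by norm_num) (by norm_num)
  have hm : AEStronglyMeasurable (Ω.indicator h) volume :=
    (aestronglyMeasurable_indicator_iff hΩ.measurableSet).2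
      (hh.aestronglyMeasurable hΩ.measurableSet)
  have huc := (isCompact_closedBall x (2 * r)).uniformContinuousOn_of_continuous (hh.mono hx)
  rw [Metric.uniformContinuousOn_iff] at huc
  rw [Metric.tendstoUniformlyOn_iff]
  intro δ hδ
  obtain ⟨η, hη, hηδ⟩ := huc (δ / 2) (half_pos hδ)
  filter_upwards [hlim.eventually (gt_mem_nhds (show 0 < min (η / 2) (r / 2) by positivity))]
    with k hk y hy
  have hk1 := hk.trans_le (min_le_left _ _)
  have hk2 := hk.trans_le (min_le_right _ _)
  have hyB : y ∈ Metric.closedBall x (2 * r) := by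
    rw [Metric.mem_ball] at hy; rw [Metric.mem_closedBall]; linarith
  have hd := dist_mollify_le (t := (1 / 2 : ℝ) ^ k) (by positivity) hm (x := y) (δ := δ / 2) ?_
  · rw [dist_comm]
    rw [indicator_of_mem (hx hyB)] at hd
    linarith
  · intro z hz
    rw [Metric.mem_ball] at hz
    have hzB : z ∈ Metric.closedBall x (2 * r) := by
      rw [Metric.mem_ball] at hy; rw [Metric.mem_closedBall]
      linarith [dist_triangle z y x]
    rw [indicator_of_mem (hx hyB), indicator_of_mem (hx hzB)]
    exact (hηδ z hzB y hyB (by linarith)).le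

/-- The covector with the given coordinates. -/
def covec (a : Fin n → ℝ) : E n →L[ℝ] ℝ := ∑ i, a i • (EuclideanSpace.proj i : E n →L[ℝ] ℝ)

lemma fderiv_eq_covec (f : E n → ℝ) (x : E n) : fderiv ℝ f x = covec fun i => pd i f x := by
  ext y
  rw [fderiv_apply_eq_sum_pd]
  simp [covec, mul_comm]

lemma dist_covec_le (a b : Fin n → ℝ) : dist (covec a) (covec b)
    ≤ ∑ i, dist (a i) (b i) * ‖(EuclideanSpace.proj i : E n →L[ℝ] ℝ)‖ := by
  rw [dist_eq_norm, covec, covec, ← Finset.sum_sub_distrib]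
  refine (norm_sum_le _ _).trans (Finset.sum_le_sum fun i _ => ?_)
  have e : a i • (EuclideanSpace.proj i : E n →L[ℝ] ℝ) - b i • EuclideanSpace.proj i
      = (a i - b i) • EuclideanSpace.proj i := by ext y; simp [sub_mul]
  rw [e, norm_smul, dist_eq_norm]

/-- Near `x` the mollifications of `g` converge to `g`, and their derivatives, being mollifications
of the `v i`, converge uniformly; so the limit may be differentiated. -/
lemma hasFDerivAt_of_hasWeakPartialDeriv {Ω : Set (E n)} (hΩ : IsOpen Ω) {g : E n → ℝ}
    {v : Fin n → E n → ℝ} (h : ∀ i, HasWeakPartialDeriv Ω i g (v i)) (hg : IntegrableOn g Ω)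
    (hgc : ContinuousOn g Ω) (hvc : ∀ i, ContinuousOn (v i) Ω) {x : E n} (hx : x ∈ Ω) :
    HasFDerivAt g (covec fun i => v i x) x := by
  obtain ⟨R, hR, hRΩ⟩ := Metric.isOpen_iff.1 hΩ x hx
  set r := R / 4 with hrdef
  have hr : 0 < r := by positivity
  have hball : Metric.closedBall x (2 * r) ⊆ Ω :=
    (Metric.closedBall_subset_ball (by linarith)).trans hRΩ
  have hlim : Tendsto (fun k : ℕ => (1 / 2 : ℝ) ^ k) atTop (𝓝 0) :=
    tendsto_pow_atTop_nhds_zero_of_lt_one (by norm_num) (by norm_num)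
  -- Discarding the first `k₀` scales keeps every mollification ball centred in `ball x r` inside
  -- `Ω`.
  obtain ⟨k₀, hk₀⟩ := eventually_atTop.1 (hlim.eventually (gt_mem_nhds (half_pos hr)))
  have hgi := (hg.integrable_indicator hΩ.measurableSet).locallyIntegrable
  have hpos : ∀ k : ℕ, (0 : ℝ) < (1 / 2) ^ k := fun k => by positivity
  have hsum : TendstoUniformlyOn
      (fun k y => covec fun i => mollify ((1 / 2 : ℝ) ^ (k + k₀)) (Ω.indicator (v i)) y)
      (fun y => covec fun i => v i y) atTop (Metric.ball x r) := by
    rw [Metric.tendstoUniformlyOn_iff]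
    intro δ hδ
    set S := ∑ i : Fin n, ‖(EuclideanSpace.proj i : E n →L[ℝ] ℝ)‖ + 1 with hS
    have hS0 : 0 < S := by positivity
    have : ∀ i, ∀ᶠ k : ℕ in atTop, ∀ y ∈ Metric.ball x r,
        dist (v i y) (mollify ((1 / 2 : ℝ) ^ (k + k₀)) (Ω.indicator (v i)) y) < δ / S := fun i =>
      (tendsto_add_atTop_nat k₀).eventually (Metric.tendstoUniformlyOn_iff.1
        (exists_ball_tendstoUniformlyOn_mollify hΩ (hvc i) hr hball) _ (by positivity))
    filter_upwards [eventually_all.2 this] with k hk y hy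
    refine (dist_covec_le _ _).trans_lt ?_
    calc _ ≤ ∑ i : Fin n, δ / S * ‖(EuclideanSpace.proj i : E n →L[ℝ] ℝ)‖ := by
          gcongr with i _
          exact (hk i y hy).le
      _ = δ / S * (S - 1) := by rw [← Finset.mul_sum, hS]; ring
      _ < δ / S * S := by gcongr; linarith
      _ = δ := by field_simp
  refine hasFDerivAt_of_tendstoUniformlyOn Metric.isOpen_ball hsum
    (f := fun k => mollify ((1 / 2 : ℝ) ^ (k + k₀)) (Ω.indicator g)) ?_ ?_
    (Metric.mem_ball_self hr)
  · intro k y hy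
    have hd := ((contDiff_mollify (hpos (k + k₀)) hgi).differentiable (by simp) y).hasFDerivAt
    rw [fderiv_eq_covec] at hd
    convert! hd using 3 with i
    refine (pd_mollify hΩ (h i) hg (hpos _) (Subset.trans ?_ hball)).symm
    intro z hz
    rw [Metric.mem_closedBall] at hz ⊢
    rw [Metric.mem_ball] at hy
    linarith [hk₀ (k + k₀) (by omega), dist_triangle z y x]
  · intro y hy
    exact ((exists_ball_tendstoUniformlyOn_mollify hΩ hgc hr hball).tendsto_at hy).comp
      (tendsto_add_atTop_nat k₀)

lemma HasWeakPartialDeriv.congr_ae {Ω : Set (E n)} {i : Fin n} {u u' v v' : E n → ℝ}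
    (h : HasWeakPartialDeriv Ω i u v) (hu : u =ᵐ[volume.restrict Ω] u')
    (hv : v =ᵐ[volume.restrict Ω] v') : HasWeakPartialDeriv Ω i u' v' where
  locInt_fun := fun x hx => by
    obtain ⟨t, ht, hi⟩ := h.locInt_fun x hx
    refine ⟨t ∩ Ω, inter_mem ht self_mem_nhdsWithin, ?_⟩
    exact (hi.mono_set inter_subset_left).congr_fun_ae
      (ae_mono (Measure.restrict_mono inter_subset_right le_rfl) hu)
  locInt_deriv := fun x hx => by
    obtain ⟨t, ht, hi⟩ := h.locInt_deriv x hx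
    refine ⟨t ∩ Ω, inter_mem ht self_mem_nhdsWithin, ?_⟩
    exact (hi.mono_set inter_subset_left).congr_fun_ae
      (ae_mono (Measure.restrict_mono inter_subset_right le_rfl) hv)
  integral_eq := fun η h1 h2 h3 => by
    have e1 : ∫ x in Ω, u' x * pd i η x = ∫ x in Ω, u x * pd i η x :=
      integral_congr_ae (hu.mono fun x hx => by simp only [hx])
    have e2 : ∫ x in Ω, v' x * η x = ∫ x in Ω, v x * η x :=
      integral_congr_ae (hv.mono fun x hx => by simp only [hx])
    rw [e1, e2, h.integral_eq η h1 h2 h3]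

lemma MemSobolev.memLp {Ω : Set (E n)} {p : ℝ≥0∞} {k : ℕ} {u : E n → ℝ} (h : MemSobolev Ω p k u) :
    MemLp u p (volume.restrict Ω) := by
  cases k with
  | zero => exact h
  | succ k => exact h.1

/-- Interior Sobolev embedding: `W^{k+1,s}` embeds into `C^k` when `s` exceeds the dimension. -/
theorem MemSobolev.exists_contDiffOn {Ω : Set (E n)} (hΩ : IsOpen Ω) (hb : Bornology.IsBounded Ω)
    {s : ℝ} (hs : 1 ≤ s) (hns : n < s) (k : ℕ) : ∀ {u : E n → ℝ},
    MemSobolev Ω (ENNReal.ofReal s) (k + 1) u →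
      ∃ u' : E n → ℝ, ContDiffOn ℝ k u' Ω ∧ u =ᵐ[volume.restrict Ω] u' := by
  have hfin : IsFiniteMeasure (volume.restrict Ω) := ⟨by simpa using hb.measure_lt_top⟩
  have hs' : (1 : ℝ≥0∞) ≤ ENNReal.ofReal s := by simpa using ENNReal.ofReal_le_ofReal hs
  induction k with
  | zero =>
    rintro u ⟨hu, hv⟩
    choose v hv1 hv2 using hv
    obtain ⟨u', h1, h2⟩ := exists_continuousOn_ae_eq hΩ hs hns hv1 (hu.integrable hs') hv2
    exact ⟨u', by simpa using h1, h2⟩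
  | succ k ih =>
    rintro u ⟨hu, hv⟩
    choose v hv1 hv2 using hv
    obtain ⟨u', h1, h2⟩ := exists_continuousOn_ae_eq hΩ hs hns hv1 (hu.integrable hs')
      fun i => (hv2 i).memLp
    choose v' hv1' hv2' using fun i => ih (hv2 i)
    refine ⟨u', ?_, h2⟩
    have hd : ∀ x ∈ Ω, HasFDerivAt u' (covec fun i => v' i x) x := fun x hx =>
      hasFDerivAt_of_hasWeakPartialDeriv hΩ (fun i => (hv1 i).congr_ae h2 (hv2' i))
        ((hu.integrable hs').congr h2) h1 (fun i => (hv1' i).continuousOn) hx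
    have hcd : ContDiffOn ℝ k (fun x => covec fun i => v' i x) Ω := by
      unfold covec
      exact ContDiffOn.sum fun i _ => (hv1' i).smul contDiffOn_const
    rw [Nat.cast_succ, contDiffOn_succ_iff_fderiv_of_isOpen hΩ]
    exact ⟨fun x hx => (hd x hx).differentiableAt.differentiableWithinAt, by simp,
      hcd.congr fun x hx => (hd x hx).fderiv⟩

/-- Two continuous functions that agree almost everywhere on an open set agree on it, so the given
`u` is already the smooth representative. -/
theorem MemSobolev.contDiffOn {Ω : Set (E n)} (hΩ : IsOpen Ω) (hb : Bornology.IsBounded Ω)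
    {s : ℝ} (hs : 1 ≤ s) (hns : n < s) {k : ℕ} {u : E n → ℝ} (hu : ContinuousOn u Ω)
    (h : MemSobolev Ω (ENNReal.ofReal s) (k + 1) u) : ContDiffOn ℝ k u Ω := by
  obtain ⟨u', h1, h2⟩ := h.exists_contDiffOn hΩ hb hs hns k
  exact h1.congr (Measure.eqOn_open_of_ae_eq h2 hΩ hu h1.continuousOn)

/-! ### Weak derivatives tested with functions that are only `C¹`. -/

lemma tendsto_half_pow : Tendsto (fun k : ℕ => (1 / 2 : ℝ) ^ k) atTop (𝓝 0) :=
  tendsto_pow_atTop_nhds_zero_of_lt_one (by norm_num) (by norm_num)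

lemma eventually_abs_mollify_sub_le {h : E n → ℝ} (hh : Continuous h) (hc : HasCompactSupport h)
    {δ : ℝ} (hδ : 0 < δ) :
    ∀ᶠ k : ℕ in atTop, ∀ x, |mollify ((1 / 2 : ℝ) ^ k) h x - h x| ≤ δ := by
  have huc := hh.uniformContinuous_of_tendsto_cocompact hc.is_zero_at_infty
  obtain ⟨η, hη, hηδ⟩ := Metric.uniformContinuous_iff.1 huc δ hδ
  filter_upwards [tendsto_half_pow.eventually (gt_mem_nhds (half_pos hη))] with k hk x
  rw [← Real.dist_eq]
  refine dist_mollify_le (by positivity) hh.aestronglyMeasurable fun y hy => (hηδ ?_).le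
  rw [Metric.mem_ball] at hy
  linarith

lemma mollify_eq_zero {h : E n → ℝ} {K : Set (E n)} (hK : ∀ x, x ∉ K → h x = 0) {t δ : ℝ}
    (ht : 0 < t) (htδ : 2 * t ≤ δ) {x : E n} (hx : x ∉ Metric.cthickening δ K) :
    mollify t h x = 0 := by
  rw [mollify_apply]
  refine integral_eq_zero_of_ae (Eventually.of_forall fun z => ?_)
  by_cases hz : z ∈ K
  · have : x - z ∉ Function.support (mollKernel n t) := by
      rw [support_mollKernel ht, mem_ball_zero_iff, ← dist_eq_norm]
      intro hlt
      exact hx (Metric.mem_cthickening_of_dist_le x z δ K hz (by linarith))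
    simp [Function.notMem_support.1 this]
  · simp [hK z hz]

lemma pd_mollify_of_contDiff {η : E n → ℝ} (hη : ContDiff ℝ 1 η) (hc : HasCompactSupport η)
    (i : Fin n) (t : ℝ) (x : E n) :
    pd i (mollify t η) x = mollify t (pd i η) x := by
  have h1 := hc.hasFDerivAt_convolution_right (ContinuousLinearMap.lsmul ℝ ℝ) (μ := volume)
    (contDiff_mollKernel t).continuous.locallyIntegrable hη x
  unfold pd
  rw [mollify, h1.fderiv, mollify, convolution, convolution, ContinuousLinearMap.integral_apply]
  · rfl
  · exact (hc.fderiv ℝ).convolutionExists_right _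
      (contDiff_mollKernel t).continuous.locallyIntegrable (hη.continuous_fderiv (by simp)) x

lemma continuous_pd {η : E n → ℝ} (hη : ContDiff ℝ 1 η) (i : Fin n) : Continuous (pd i η) :=
  (hη.continuous_fderiv (by simp)).clm_apply continuous_const

/-- A common compact `K` carries all the integrands, and once `|a k - b| ≤ 1` they are dominated by
`|f| (C + 1)`, integrable on `K`. -/
lemma tendsto_integral_mul_of_uniform {Ω : Set (E n)} (hΩ : MeasurableSet Ω) {f : E n → ℝ}
    (hf : LocallyIntegrableOn f Ω) {K : Set (E n)} (hK : IsCompact K) (hKΩ : K ⊆ Ω)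
    {a : ℕ → E n → ℝ} {b : E n → ℝ} (ha : ∀ k, Continuous (a k)) (hb : Continuous b)
    (ha0 : ∀ᶠ k in atTop, ∀ x, x ∉ K → a k x = 0) (hb0 : ∀ x, x ∉ K → b x = 0)
    (h : ∀ δ > 0, ∀ᶠ k in atTop, ∀ x, |a k x - b x| ≤ δ) :
    Tendsto (fun k => ∫ x in Ω, f x * a k x) atTop (𝓝 (∫ x in Ω, f x * b x)) := by
  have hfK : IntegrableOn f K := hf.integrableOn_compact_subset hKΩ hK
  obtain ⟨C, hC⟩ := hK.exists_bound_of_continuousOn hb.continuousOn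
  have key : ∀ c : E n → ℝ, (∀ x, x ∉ K → c x = 0) →
      ∫ x in Ω, f x * c x = ∫ x in K, f x * c x := fun c hc =>
    setIntegral_eq_of_subset_of_forall_sdiff_eq_zero hΩ hKΩ fun x hx => by rw [hc x hx.2, mul_zero]
  rw [key b hb0]
  refine Tendsto.congr' (ha0.mono fun k hk => (key (a k) hk).symm) ?_
  refine tendsto_integral_filter_of_dominated_convergence (fun x => |f x| * (C + 1)) ?_ ?_ ?_ ?_
  · exact Eventually.of_forall fun k => hfK.1.mul (ha k).aestronglyMeasurable
  · filter_upwards [h 1 one_pos] with k hk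
    refine (ae_restrict_iff' hK.measurableSet).2 (Eventually.of_forall fun x hx => ?_)
    rw [norm_mul, Real.norm_eq_abs, Real.norm_eq_abs]
    gcongr
    have h1 := hC x hx
    rw [Real.norm_eq_abs] at h1
    have h2 := abs_sub_abs_le_abs_sub (a k x) (b x)
    linarith [hk x]
  · exact hfK.abs.mul_const _
  · refine Eventually.of_forall fun x => Tendsto.const_mul _ ?_
    rw [Metric.tendsto_atTop']
    intro δ hδ
    obtain ⟨N, hN⟩ := eventually_atTop.1 (h (δ / 2) (half_pos hδ))
    exact ⟨N, fun k hk => by rw [Real.dist_eq]; linarith [hN k (le_of_lt hk) x]⟩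

/-- Continuously differentiable compactly supported functions are admissible tests for weak
derivatives. -/
lemma HasWeakPartialDeriv.integral_eq_of_contDiff {Ω : Set (E n)} (hΩ : IsOpen Ω) {i : Fin n}
    {u v η : E n → ℝ} (h : HasWeakPartialDeriv Ω i u v) (hη : ContDiff ℝ 1 η) {K : Set (E n)}
    (hK : IsCompact K) (hKΩ : K ⊆ Ω) (hη0 : ∀ x, x ∉ K → η x = 0) :
    ∫ x in Ω, u x * pd i η x = - ∫ x in Ω, v x * η x := by
  -- Mollifying spreads the support; this thickening contains the supports of all mollifications at
  -- small scale.
  obtain ⟨δ, hδ, hδΩ⟩ := hK.exists_cthickening_subset_open hΩ hKΩ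
  have hK' : IsCompact (Metric.cthickening δ K) := hK.cthickening
  have hKK' : K ⊆ Metric.cthickening δ K := Metric.self_subset_cthickening K
  have hc : HasCompactSupport η := HasCompactSupport.intro hK hη0
  have hpd0 : ∀ x, x ∉ K → pd i η x = 0 := by
    intro x hx
    have : η =ᶠ[𝓝 x] fun _ => 0 := by
      filter_upwards [hK.isClosed.isOpen_compl.mem_nhds hx] with y hy using hη0 y hy
    rw [pd, this.fderiv_eq]; simp
  have hpdc : HasCompactSupport (pd i η) := HasCompactSupport.intro hK hpd0
  have hpos : ∀ k : ℕ, (0 : ℝ) < (1 / 2) ^ k := fun k => by positivity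
  have hsm : ∀ k : ℕ, ContDiff ℝ ∞ (mollify ((1 / 2) ^ k) η) := fun k =>
    contDiff_mollify (hpos k) hη.continuous.locallyIntegrable
  have hev : ∀ᶠ k : ℕ in atTop, 2 * (1 / 2 : ℝ) ^ k ≤ δ :=
    (tendsto_half_pow.eventually (gt_mem_nhds (half_pos hδ))).mono fun k hk => by linarith
  have lim1 : Tendsto (fun k : ℕ => ∫ x in Ω, u x * pd i (mollify ((1 / 2) ^ k) η) x) atTop
      (𝓝 (∫ x in Ω, u x * pd i η x)) := by
    refine tendsto_integral_mul_of_uniform hΩ.measurableSet h.locInt_fun hK' hδΩ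
      (fun k => continuous_pd ((hsm k).of_le (by simp)) i) (continuous_pd hη i) ?_
      (fun x hx => hpd0 x fun h => hx (hKK' h)) ?_
    · filter_upwards [hev] with k hk x hx
      rw [pd_mollify_of_contDiff hη hc i]
      exact mollify_eq_zero hpd0 (hpos k) hk hx
    · intro ε hε
      filter_upwards [eventually_abs_mollify_sub_le (continuous_pd hη i) hpdc hε] with k hk x
      rw [pd_mollify_of_contDiff hη hc i]
      exact hk x
  have lim2 : Tendsto (fun k : ℕ => - ∫ x in Ω, v x * mollify ((1 / 2) ^ k) η x) atTop
      (𝓝 (- ∫ x in Ω, v x * η x)) := by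
    refine (tendsto_integral_mul_of_uniform hΩ.measurableSet h.locInt_deriv hK' hδΩ
      (fun k => (hsm k).continuous) hη.continuous ?_ (fun x hx => hη0 x fun h => hx (hKK' h))
      fun ε hε => eventually_abs_mollify_sub_le hη.continuous hc hε).neg
    filter_upwards [hev] with k hk x hx
    exact mollify_eq_zero hη0 (hpos k) hk hx
  refine tendsto_nhds_unique (lim1.congr' ?_) lim2
  filter_upwards [hev] with k hk
  have hsupp : tsupport (mollify ((1 / 2) ^ k) η) ⊆ Metric.cthickening δ K :=
    closure_minimal (fun x hx => by
      by_contra hx'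
      exact hx (mollify_eq_zero hη0 (hpos k) hk hx')) Metric.isClosed_cthickening
  exact h.integral_eq _ (hsm k)
    (HasCompactSupport.of_support_subset_isCompact hK' ((subset_tsupport _).trans hsupp))
    (hsupp.trans hδΩ)

/-! ### Determinants, cofactors and Hessians. -/

/-- Jacobi's formula, with no invertibility: the Leibniz expansion gives a sum of determinants with
one column differentiated, and Cramer's rule reads these as diagonal entries of `adj(A) A'`. -/
lemma hasDerivAt_det {A : ℝ → Matrix (Fin n) (Fin n) ℝ} {A' : Matrix (Fin n) (Fin n) ℝ} {t : ℝ}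
    (h : ∀ i j, HasDerivAt (fun s => A s i j) (A' i j) t) :
    HasDerivAt (fun s => (A s).det) ((A t).adjugate * A').trace t := by
  have h1 : HasDerivAt (fun s => (A s).det) (∑ σ : Equiv.Perm (Fin n), ((Equiv.Perm.sign σ : ℤ) : ℝ) *
      ∑ i, (∏ j ∈ Finset.univ.erase i, A t (σ j) j) * A' (σ i) i) t := by
    simp only [Matrix.det_apply']
    refine HasDerivAt.fun_sum fun σ _ => HasDerivAt.const_mul _ ?_
    have := HasDerivAt.fun_finsetProd (u := Finset.univ) (f := fun j s => A s (σ j) j)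
      (f' := fun j => A' (σ j) j) (x := t) fun j _ => h (σ j) j
    simpa using this
  refine h1.congr_deriv ?_
  have h2 : ∀ i, ((A t).adjugate * A') i i = ((A t).updateCol i fun k => A' k i).det := by
    intro i
    rw [← Matrix.cramer_apply, Matrix.cramer_eq_adjugate_mulVec]
    rfl
  simp only [Matrix.trace, Matrix.diag_apply, h2, Matrix.det_apply', Finset.mul_sum]
  rw [Finset.sum_comm]
  refine Finset.sum_congr rfl fun i _ => Finset.sum_congr rfl fun σ _ => ?_
  congr 1
  rw [← Finset.prod_erase_mul _ _ (Finset.mem_univ i)]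
  congr 1
  · refine Finset.prod_congr rfl fun j hj => ?_
    rw [Matrix.updateCol_ne (Finset.ne_of_mem_erase hj)]
  · simp

lemma contDiffOn_det {m : ℕ} {Ω : Set (E n)} {k : WithTop ℕ∞}
    {A : E n → Matrix (Fin m) (Fin m) ℝ}
    (h : ∀ i j, ContDiffOn ℝ k (fun x => A x i j) Ω) : ContDiffOn ℝ k (fun x => (A x).det) Ω := by
  simp only [Matrix.det_apply']
  exact ContDiffOn.sum fun σ _ => contDiffOn_const.mul (contDiffOn_prod fun j _ => h _ _)

lemma contDiffOn_adjugate {m : ℕ} {Ω : Set (E n)} {k : WithTop ℕ∞}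
    {A : E n → Matrix (Fin m) (Fin m) ℝ}
    (h : ∀ i j, ContDiffOn ℝ k (fun x => A x i j) Ω) (i j : Fin m) :
    ContDiffOn ℝ k (fun x => (A x).adjugate i j) Ω := by
  simp only [Matrix.adjugate_apply]
  refine contDiffOn_det fun a b => ?_
  by_cases ha : a = j
  · subst ha; simp only [Matrix.updateRow_self]; exact contDiffOn_const
  · simp only [Matrix.updateRow_ne ha]; exact h a b

lemma hasDerivAt_comp_line_pd {f : E n → ℝ} {x : E n} (hf : DifferentiableAt ℝ f x) (i : Fin n) :
    HasDerivAt (fun t : ℝ => f (x + t • basisVec i)) (pd i f x) 0 := by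
  have h1 : HasDerivAt (fun t : ℝ => x + t • basisVec i) (basisVec i : E n) 0 := by
    simpa using ((hasDerivAt_id (0 : ℝ)).smul_const (basisVec i : E n)).const_add x
  have h2 : HasFDerivAt f (fderiv ℝ f x) (x + (0 : ℝ) • basisVec i) := by
    simpa using hf.hasFDerivAt
  exact h2.comp_hasDerivAt 0 h1

lemma pd_congr {f g : E n → ℝ} {x : E n} (h : f =ᶠ[𝓝 x] g) (i : Fin n) : pd i f x = pd i g x := by
  rw [pd, pd, h.fderiv_eq]

lemma contDiffOn_pd {Ω : Set (E n)} (hΩ : IsOpen Ω) {k m : WithTop ℕ∞} (hkm : k + 1 ≤ m)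
    {f : E n → ℝ} (h : ContDiffOn ℝ m f Ω) (i : Fin n) : ContDiffOn ℝ k (pd i f) Ω :=
  ((contDiffOn_succ_iff_fderiv_of_isOpen hΩ).1 (h.of_le hkm)).2.2.clm_apply contDiffOn_const

lemma contDiffOn_hess {Ω : Set (E n)} (hΩ : IsOpen Ω) {k m : WithTop ℕ∞} (hkm : k + 1 + 1 ≤ m)
    {f : E n → ℝ} (h : ContDiffOn ℝ m f Ω) (i j : Fin n) :
    ContDiffOn ℝ k (fun x => hess f x i j) Ω :=
  contDiffOn_pd hΩ le_rfl (contDiffOn_pd hΩ hkm h i) j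

lemma pd_comm {f : E n → ℝ} {x : E n} (h : ContDiffAt ℝ 2 f x) (i j : Fin n) :
    pd i (pd j f) x = pd j (pd i f) x := by
  have hs := h.isSymmSndFDerivAt (by simp)
  have hd : DifferentiableAt ℝ (fderiv ℝ f) x :=
    (h.fderiv_right (m := 1) (by norm_num)).differentiableAt (by simp)
  have key : ∀ a b, pd a (pd b f) x = fderiv ℝ (fderiv ℝ f) x (basisVec a) (basisVec b) := by
    intro a b
    have : HasFDerivAt (pd b f) _ x := hd.hasFDerivAt.clm_apply (hasFDerivAt_const (basisVec b) x)
    rw [pd, this.fderiv]; simp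
  rw [key, key]; exact hs _ _

lemma hess_isSymm {f : E n → ℝ} {x : E n} (h : ContDiffAt ℝ 2 f x) : (hess f x).IsSymm := by
  ext i j
  exact pd_comm h i j

/-- The rows of the cofactor matrix of a nondegenerate Hessian are divergence free. -/
lemma sum_pd_cofHess {Ω : Set (E n)} (hΩ : IsOpen Ω) {f : E n → ℝ} (hf : ContDiffOn ℝ 3 f Ω)
    {x : E n} (hx : x ∈ Ω) (hdet : (hess f x).det ≠ 0) (i : Fin n) :
    ∑ k, pd k (fun y => cofHess f y i k) x = 0 := by
  have hH : ∀ i j, ContDiffOn ℝ 1 (fun y => hess f y i j) Ω := fun i j =>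
    contDiffOn_hess hΩ (by norm_num) hf i j
  have hC : ∀ i j, ContDiffOn ℝ 1 (fun y => cofHess f y i j) Ω := contDiffOn_adjugate hH
  have hdiff : ∀ {g : E n → ℝ}, ContDiffOn ℝ 1 g Ω → DifferentiableAt ℝ g x := fun hg =>
    (hg.contDiffAt (hΩ.mem_nhds hx)).differentiableAt (by simp)
  set B := cofHess f x with hB
  set T : Fin n → Matrix (Fin n) (Fin n) ℝ := fun k =>
    Matrix.of fun a b => pd k (fun y => hess f y a b) x with hT
  set D : Fin n → Matrix (Fin n) (Fin n) ℝ := fun k =>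
    Matrix.of fun a b => pd k (fun y => cofHess f y a b) x with hD
  have hsymm1 : ∀ k a b, T k a b = T k b a := fun k a b => by
    refine pd_congr ?_ k
    filter_upwards [hΩ.mem_nhds hx] with y hy
    exact pd_comm ((hf.contDiffAt (hΩ.mem_nhds hy)).of_le (by norm_num)) _ _
  have hsymm2 : ∀ k a b, T k a b = T b a k := fun k a b =>
    pd_comm ((contDiffOn_pd hΩ (k := 2) (by norm_num) hf a).contDiffAt (hΩ.mem_nhds hx)) _ _
  -- Differentiate `adj(D²f) D²f = det(D²f) 1` in direction `k`; the right side is Jacobi's formula.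
  have hprod : ∀ k, D k * hess f x + B * T k = (B * T k).trace • 1 := by
    intro k
    ext a b
    have h1 : HasDerivAt (fun t : ℝ => (cofHess f (x + t • basisVec k) *
        hess f (x + t • basisVec k)) a b) ((D k * hess f x + B * T k) a b) 0 := by
      simp only [Matrix.mul_apply, Matrix.add_apply, ← Finset.sum_add_distrib]
      refine HasDerivAt.fun_sum fun c _ => ?_
      have := (hasDerivAt_comp_line_pd (hdiff (hC a c)) k).mul (hasDerivAt_comp_line_pd (hdiff (hH c b)) k)
      simp only [zero_smul, add_zero] at this
      exact this
    have h2 := (hasDerivAt_det fun i j => hasDerivAt_comp_line_pd (hdiff (hH i j)) k).mul_const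
      ((1 : Matrix (Fin n) (Fin n) ℝ) a b)
    simp only [zero_smul, add_zero] at h2
    refine h1.unique (h2.congr_of_eventuallyEq (Eventually.of_forall fun t => ?_))
    simp only [cofHess, Matrix.adjugate_mul, Matrix.smul_apply, smul_eq_mul]
  -- Multiplying by `B` on the right turns `D²f B` into `det(D²f) 1` and so isolates `D k`.
  have hDk : ∀ k, (hess f x).det • D k = (B * T k).trace • B - B * T k * B := by
    intro k
    have h1 := congrArg (· * B) (hprod k)
    simp only [add_mul, Matrix.smul_mul, one_mul, mul_assoc] at h1
    rw [hB, cofHess, Matrix.mul_adjugate, Matrix.mul_smul, mul_one] at h1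
    rw [mul_assoc]
    exact eq_sub_of_add_eq h1
  have hmain : (hess f x).det * ∑ k, D k i k = 0 := by
    rw [Finset.mul_sum]
    have h1 : ∀ k, (hess f x).det * D k i k = (B * T k).trace * B i k - (B * T k * B) i k :=
      fun k => by simpa using congrFun (congrFun (hDk k) i) k
    simp only [h1, Finset.sum_sub_distrib, sub_eq_zero, Matrix.trace, Matrix.diag_apply,
      Matrix.mul_apply, Finset.sum_mul]
    -- Third derivatives are symmetric in all three indices, so the two contractions agree after
    -- relabelling.
    calc ∑ k, ∑ a, ∑ b, B a b * T k b a * B i k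
        = ∑ k, ∑ a, ∑ b, B i k * T b k a * B a b := by
          refine Finset.sum_congr rfl fun k _ => Finset.sum_congr rfl fun a _ =>
            Finset.sum_congr rfl fun b _ => ?_
          rw [hsymm1 k b a, hsymm2 k a b, hsymm1 b a k]; ring
      _ = ∑ b, ∑ a, ∑ k, B i k * T b k a * B a b := by
          rw [Finset.sum_comm, Finset.sum_congr rfl fun a _ => Finset.sum_comm, Finset.sum_comm]
  exact (mul_eq_zero.1 hmain).resolve_left hdet

/-- Writing `B = CᵀC`, the trace becomes that of `C A Cᵀ`, which is positive semidefinite. -/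
lemma trace_mul_nonneg {A B : Matrix (Fin n) (Fin n) ℝ} (hA : A.PosSemidef) (hB : B.PosSemidef) :
    0 ≤ (A * B).trace := by
  obtain ⟨C, rfl⟩ : ∃ C : Matrix (Fin n) (Fin n) ℝ, B = C.conjTranspose * C := by
    open scoped MatrixOrder Matrix.Norms.L2Operator in
    exact CStarAlgebra.nonneg_iff_eq_star_mul_self.mp hB.nonneg
  rw [← mul_assoc, Matrix.trace_mul_comm, ← mul_assoc]
  exact (hA.mul_mul_conjTranspose_same C).trace_nonneg

lemma hasDerivAt_line {f : E n → ℝ} {x h : E n} {t : ℝ} (hf : DifferentiableAt ℝ f (x + t • h)) :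
    HasDerivAt (fun t : ℝ => f (x + t • h)) (fderiv ℝ f (x + t • h) h) t := by
  have h1 : HasDerivAt (fun t : ℝ => x + t • h) h t := by
    simpa using ((hasDerivAt_id t).smul_const h).const_add x
  exact hf.hasFDerivAt.comp_hasDerivAt t h1

lemma dotProduct_hess_mulVec {f : E n → ℝ} {x : E n} (h : E n) :
    (h : Fin n → ℝ) ⬝ᵥ (hess f x).mulVec h = ∑ i, h i * fderiv ℝ (pd i f) x h := by
  simp only [dotProduct, Matrix.mulVec, hess, Matrix.of_apply, fderiv_apply_eq_sum_pd _ x h]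
  refine Finset.sum_congr rfl fun i _ => ?_
  congr 1
  exact Finset.sum_congr rfl fun j _ => mul_comm _ _

/-- The Hessian of a convex function is positive semidefinite. -/
lemma hess_posSemidef {Ω : Set (E n)} (hΩ : IsOpen Ω) {f : E n → ℝ} (hf : ContDiffOn ℝ 2 f Ω)
    (hc : ConvexOn ℝ Ω f) {x : E n} (hx : x ∈ Ω) : (hess f x).PosSemidef := by
  have hat : ∀ y ∈ Ω, ContDiffAt ℝ 2 f y := fun y hy => hf.contDiffAt (hΩ.mem_nhds hy)
  refine .of_dotProduct_mulVec_nonneg ?_ fun v => ?_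
  · rw [Matrix.IsHermitian, Matrix.conjTranspose_eq_transpose_of_trivial]
    exact hess_isSymm (hat x hx)
  · set h : E n := WithLp.toLp 2 v
    rw [star_trivial]
    change 0 ≤ (h : Fin n → ℝ) ⬝ᵥ (hess f x).mulVec h
    rw [dotProduct_hess_mulVec]
    set L : ℝ → E n := fun t => x + t • h with hL
    have hLc : Continuous L := by fun_prop
    set S := L ⁻¹' Ω with hS
    have hSo : IsOpen S := hΩ.preimage hLc
    have h0 : (0 : ℝ) ∈ S := by simpa [hS, hL] using hx
    -- Restricted to a line the function is convex, so its first derivative is monotone, and the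
    -- derivative of that at `0` is the quadratic form.
    have hconv : ConvexOn ℝ S (fun t => f (L t)) := by
      have := hc.comp_affineMap (AffineMap.lineMap x (x + h) : ℝ →ᵃ[ℝ] E n)
      have e : ∀ t : ℝ, (AffineMap.lineMap x (x + h) : ℝ →ᵃ[ℝ] E n) t = L t := fun t => by
        simp [AffineMap.lineMap_apply, hL, add_comm]
      have e' : (⇑(AffineMap.lineMap x (x + h) : ℝ →ᵃ[ℝ] E n)) = L := funext e
      rwa [e'] at this
    have hd1 : ∀ t ∈ S, HasDerivAt (fun t => f (L t)) (fderiv ℝ f (L t) h) t := fun t ht =>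
      hasDerivAt_line ((hat _ ht).differentiableAt (by simp))
    have hmono : MonotoneOn (fun t => fderiv ℝ f (L t) h) S := by
      refine (hconv.monotoneOn_deriv fun t ht => (hd1 t ht).differentiableAt).congr fun t ht => ?_
      exact (hd1 t ht).deriv
    have hd2 : HasDerivAt (fun t => fderiv ℝ f (L t) h)
        (∑ i, h i * fderiv ℝ (pd i f) x h) 0 := by
      simp only [fderiv_apply_eq_sum_pd f _ h]
      refine HasDerivAt.fun_sum fun i _ => HasDerivAt.const_mul _ ?_
      have hpd : DifferentiableAt ℝ (pd i f) x :=
        ((contDiffOn_pd hΩ (k := 1) (by norm_num) hf i).contDiffAt (hΩ.mem_nhds hx)).differentiableAt (by simp)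
      have e0 : x + (0 : ℝ) • h = x := by simp
      have := hasDerivAt_line (f := pd i f) (x := x) (h := h) (t := 0) (by rwa [e0])
      rwa [e0] at this
    exact hd2.hasDerivWithinAt.nonneg_of_monotoneOn
      (by
        rw [AccPt, inf_eq_left.2 (le_principal_iff.2 (mem_nhdsWithin_of_mem_nhds (hSo.mem_nhds h0)))]
        infer_instance) hmono

/-! ### Double integration by parts for the cofactor operator. -/

lemma contDiff_of_contDiffOn_of_eq_zero {Ω K : Set (E n)} (hΩ : IsOpen Ω) (hK : IsClosed K)
    (hKΩ : K ⊆ Ω) {k : WithTop ℕ∞} {a : E n → ℝ} (ha : ContDiffOn ℝ k a Ω)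
    (h0 : ∀ x, x ∉ K → a x = 0) : ContDiff ℝ k a := by
  rw [contDiff_iff_contDiffAt]
  intro x
  by_cases hx : x ∈ K
  · exact ha.contDiffAt (hΩ.mem_nhds (hKΩ hx))
  · refine (contDiffAt_const (c := (0 : ℝ))).congr_of_eventuallyEq ?_
    filter_upwards [hK.isOpen_compl.mem_nhds hx] with y hy using h0 y hy

lemma pd_eq_zero {K : Set (E n)} (hK : IsClosed K) {a : E n → ℝ} (h0 : ∀ x, x ∉ K → a x = 0)
    (i : Fin n) {x : E n} (hx : x ∉ K) : pd i a x = 0 := by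
  have : a =ᶠ[𝓝 x] fun _ => 0 := by
    filter_upwards [hK.isOpen_compl.mem_nhds hx] with y hy using h0 y hy
  rw [pd, this.fderiv_eq]; simp

lemma integrableOn_mul_of_eq_zero {Ω K : Set (E n)} (hΩ : MeasurableSet Ω) (hK : IsCompact K)
    (hKΩ : K ⊆ Ω) {f a : E n → ℝ} (hf : LocallyIntegrableOn f Ω) (ha : ContinuousOn a K)
    (h0 : ∀ x, x ∉ K → a x = 0) : IntegrableOn (fun x => f x * a x) Ω :=
  IntegrableOn.of_forall_sdiff_eq_zero
    ((hf.integrableOn_compact_subset hKΩ hK).mul_continuousOn ha hK) hΩ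
    fun x hx => by rw [h0 x hx.2, mul_zero]

lemma pd_mul {a b : E n → ℝ} {x : E n} (ha : DifferentiableAt ℝ a x) (hb : DifferentiableAt ℝ b x)
    (i : Fin n) : pd i (fun y => a y * b y) x = pd i a x * b x + a x * pd i b x := by
  rw [pd, fderiv_fun_mul ha hb]
  simp [pd]; ring

/-- Integrating the cofactor operator by parts twice. -/
lemma integral_cofHess_mul {Ω K : Set (E n)} (hΩ : IsOpen Ω) (hK : IsCompact K) (hKΩ : K ⊆ Ω)
    {u η w : E n → ℝ} {w₁ : Fin n → E n → ℝ} {w₂ : Fin n → Fin n → E n → ℝ}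
    (hu : ContDiffOn ℝ 3 u Ω) (hdet : ∀ x ∈ Ω, (hess u x).det ≠ 0)
    (h₁ : ∀ i, HasWeakPartialDeriv Ω i w (w₁ i))
    (h₂ : ∀ i j, HasWeakPartialDeriv Ω j (w₁ i) (w₂ i j))
    (hη : ContDiffOn ℝ 2 η Ω) (hη0 : ∀ x, x ∉ K → η x = 0) :
    IntegrableOn (fun x => (∑ i, ∑ j, cofHess u x i j * w₂ i j x) * η x) Ω ∧
    IntegrableOn (fun x => w x * ∑ i, ∑ j, cofHess u x i j * hess η x i j) Ω ∧
    ∫ x in Ω, (∑ i, ∑ j, cofHess u x i j * w₂ i j x) * η x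
      = ∫ x in Ω, w x * ∑ i, ∑ j, cofHess u x i j * hess η x i j := by
  have hU : ∀ i j, ContDiffOn ℝ 1 (fun x => cofHess u x i j) Ω :=
    contDiffOn_adjugate fun i j => contDiffOn_hess hΩ (by norm_num) hu i j
  have hpd : ∀ j, ContDiffOn ℝ 1 (pd j η) Ω := contDiffOn_pd hΩ (by norm_num) hη
  have hpd0 : ∀ j x, x ∉ K → pd j η x = 0 := fun j x => pd_eq_zero hK.isClosed hη0 j
  have hη1 : ContDiffOn ℝ 1 η Ω := hη.of_le (by norm_num)
  have hA : ∀ i j, ContDiff ℝ 1 fun x => cofHess u x i j * η x := fun i j =>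
    contDiff_of_contDiffOn_of_eq_zero hΩ hK.isClosed hKΩ ((hU i j).mul hη1)
      fun x hx => by rw [hη0 x hx, mul_zero]
  have hB : ∀ i j, ContDiff ℝ 1 fun x => cofHess u x i j * pd j η x := fun i j =>
    contDiff_of_contDiffOn_of_eq_zero hΩ hK.isClosed hKΩ ((hU i j).mul (hpd j))
      fun x hx => by rw [hpd0 j x hx, mul_zero]
  have hA0 : ∀ i j, ∀ x, x ∉ K → cofHess u x i j * η x = 0 := fun i j x hx => by
    rw [hη0 x hx, mul_zero]
  have hB0 : ∀ i j, ∀ x, x ∉ K → cofHess u x i j * pd j η x = 0 := fun i j x hx => by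
    rw [hpd0 j x hx, mul_zero]
  have hd : ∀ {a : E n → ℝ} {x}, ContDiffOn ℝ 1 a Ω → x ∈ Ω → DifferentiableAt ℝ a x :=
    fun ha hx => (ha.contDiffAt (hΩ.mem_nhds hx)).differentiableAt (by simp)
  have hsymU : ∀ x ∈ Ω, ∀ i j, cofHess u x i j = cofHess u x j i := fun x hx i j => by
    have h := hess_isSymm ((hu.contDiffAt (hΩ.mem_nhds hx)).of_le (by norm_num))
    have : (cofHess u x).transpose = cofHess u x := by
      rw [cofHess, Matrix.adjugate_transpose, h.eq]
    exact congrFun (congrFun this j) i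
  have hint1 : ∀ i j, IntegrableOn (fun x => w₂ i j x * (cofHess u x i j * η x)) Ω := fun i j =>
    integrableOn_mul_of_eq_zero hΩ.measurableSet hK hKΩ (h₂ i j).locInt_deriv
      (hA i j).continuous.continuousOn (hA0 i j)
  have hint2 : ∀ i j, IntegrableOn (fun x => w₁ i x * pd j (fun x => cofHess u x i j * η x) x) Ω :=
    fun i j => integrableOn_mul_of_eq_zero hΩ.measurableSet hK hKΩ (h₁ i).locInt_deriv
      (continuous_pd (hA i j) j).continuousOn fun x => pd_eq_zero hK.isClosed (hA0 i j) j
  have hint3 : ∀ i j, IntegrableOn (fun x => w₁ i x * (cofHess u x i j * pd j η x)) Ω :=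
    fun i j => integrableOn_mul_of_eq_zero hΩ.measurableSet hK hKΩ (h₁ i).locInt_deriv
      (hB i j).continuous.continuousOn (hB0 i j)
  have hint4 : ∀ i j, IntegrableOn (fun x => w x * pd i (fun x => cofHess u x i j * pd j η x) x) Ω :=
    fun i j => integrableOn_mul_of_eq_zero hΩ.measurableSet hK hKΩ (h₁ i).locInt_fun
      (continuous_pd (hB i j) i).continuousOn fun x => pd_eq_zero hK.isClosed (hB0 i j) i
  have e1 : ∀ x, (∑ i, ∑ j, cofHess u x i j * w₂ i j x) * η x
      = ∑ i, ∑ j, w₂ i j x * (cofHess u x i j * η x) := fun x => by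
    simp only [Finset.sum_mul]
    exact Finset.sum_congr rfl fun i _ => Finset.sum_congr rfl fun j _ => by ring
  -- Terms with the derivative on the cofactors sum to zero, as the rows are divergence free.
  have e2 : ∀ x ∈ Ω, ∑ i, ∑ j, w₁ i x * pd j (fun x => cofHess u x i j * η x) x
      = ∑ i, ∑ j, w₁ i x * (cofHess u x i j * pd j η x) := fun x hx => by
    refine Finset.sum_congr rfl fun i _ => ?_
    rw [← Finset.mul_sum, ← Finset.mul_sum]
    simp only [pd_mul (hd (hU _ _) hx) (hd hη1 hx), Finset.sum_add_distrib, ← Finset.sum_mul]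
    rw [sum_pd_cofHess hΩ hu hx (hdet x hx) i, zero_mul, zero_add]
  -- The second integration differentiates along the other index; symmetry of the cofactor matrix
  -- makes its columns divergence free as well.
  have e3 : ∀ x ∈ Ω, ∑ i, ∑ j, w x * pd i (fun x => cofHess u x i j * pd j η x) x
      = w x * ∑ i, ∑ j, cofHess u x i j * hess η x i j := fun x hx => by
    simp only [← Finset.mul_sum]
    rw [Finset.sum_comm]
    simp only [pd_mul (hd (hU _ _) hx) (hd (hpd _) hx), Finset.sum_add_distrib, ← Finset.sum_mul]
    have hz : ∀ j, ∑ i, pd i (fun y => cofHess u y i j) x = 0 := fun j => by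
      rw [← sum_pd_cofHess hΩ hu hx (hdet x hx) j]
      refine Finset.sum_congr rfl fun i _ => pd_congr ?_ i
      filter_upwards [hΩ.mem_nhds hx] with y hy using hsymU y hy i j
    simp only [hz, zero_mul, Finset.sum_const_zero, zero_add]
    congr 1
    exact Finset.sum_congr rfl fun j _ => Finset.sum_congr rfl fun i _ => by
      rw [hsymU x hx i j]; rfl
  have i3 : IntegrableOn (fun x => ∑ i, ∑ j, w x * pd i (fun x => cofHess u x i j * pd j η x) x) Ω :=
    integrable_finsetSum _ fun i _ => integrable_finsetSum _ fun j _ => hint4 i j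
  refine ⟨?_, i3.congr_fun e3 hΩ.measurableSet, ?_⟩
  · simp only [e1]
    exact integrable_finsetSum _ fun i _ => integrable_finsetSum _ fun j _ => hint1 i j
  calc ∫ x in Ω, (∑ i, ∑ j, cofHess u x i j * w₂ i j x) * η x
      = ∑ i, ∑ j, ∫ x in Ω, w₂ i j x * (cofHess u x i j * η x) := by
        simp only [e1]
        rw [integral_finsetSum _ fun i _ => integrable_finsetSum _ fun j _ => hint1 i j]
        exact Finset.sum_congr rfl fun i _ => integral_finsetSum _ fun j _ => hint1 i j
    _ = -∑ i, ∑ j, ∫ x in Ω, w₁ i x * pd j (fun x => cofHess u x i j * η x) x := by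
        simp only [← Finset.sum_neg_distrib]
        refine Finset.sum_congr rfl fun i _ => Finset.sum_congr rfl fun j _ => ?_
        rw [(h₂ i j).integral_eq_of_contDiff hΩ (hA i j) hK hKΩ (hA0 i j), neg_neg]
    _ = -∫ x in Ω, ∑ i, ∑ j, w₁ i x * pd j (fun x => cofHess u x i j * η x) x := by
        rw [integral_finsetSum _ fun i _ => integrable_finsetSum _ fun j _ => hint2 i j]
        congr 1
        exact Finset.sum_congr rfl fun i _ => (integral_finsetSum _ fun j _ => hint2 i j).symm
    _ = -∫ x in Ω, ∑ i, ∑ j, w₁ i x * (cofHess u x i j * pd j η x) := by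
        rw [setIntegral_congr_fun hΩ.measurableSet e2]
    _ = -∑ i, ∑ j, ∫ x in Ω, w₁ i x * (cofHess u x i j * pd j η x) := by
        rw [integral_finsetSum _ fun i _ => integrable_finsetSum _ fun j _ => hint3 i j]
        congr 1
        exact Finset.sum_congr rfl fun i _ => integral_finsetSum _ fun j _ => hint3 i j
    _ = ∑ i, ∑ j, ∫ x in Ω, w x * pd i (fun x => cofHess u x i j * pd j η x) x := by
        simp only [← Finset.sum_neg_distrib]
        refine Finset.sum_congr rfl fun i _ => Finset.sum_congr rfl fun j _ => ?_
        rw [(h₁ i).integral_eq_of_contDiff hΩ (hB i j) hK hKΩ (hB0 i j)]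
    _ = ∫ x in Ω, ∑ i, ∑ j, w x * pd i (fun x => cofHess u x i j * pd j η x) x := by
        rw [integral_finsetSum _ fun i _ => integrable_finsetSum _ fun j _ => hint4 i j]
        exact Finset.sum_congr rfl fun i _ => (integral_finsetSum _ fun j _ => hint4 i j).symm
    _ = _ := setIntegral_congr_fun hΩ.measurableSet e3

/-! ### The concave test function and its pointwise inequality. -/

lemma hasDerivAt_max_zero_pow (k : ℕ) (s : ℝ) :
    HasDerivAt (fun s : ℝ => max s 0 ^ (k + 2)) ((k + 2) * max s 0 ^ (k + 1)) s := by
  rcases lt_trichotomy s 0 with hs | rfl | hs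
  · rw [max_eq_right hs.le, zero_pow (by omega), mul_zero]
    refine (hasDerivAt_const s (0 : ℝ)).congr_of_eventuallyEq ?_
    filter_upwards [gt_mem_nhds hs] with y hy
    rw [max_eq_right hy.le, zero_pow (by omega)]
  · rw [max_self, zero_pow (by omega), mul_zero, hasDerivAt_iff_isLittleO_nhds_zero]
    simp only [zero_add, max_self, smul_zero, sub_zero, ne_eq, Nat.add_eq_zero_iff,
      OfNat.ofNat_ne_zero, and_false, not_false_eq_true, zero_pow]
    have h1 : (fun h : ℝ => max h 0 ^ (k + 2)) =O[𝓝 0] fun h : ℝ => h ^ (k + 2) := by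
      refine Asymptotics.IsBigO.of_bound 1 (Eventually.of_forall fun h => ?_)
      rw [one_mul, norm_pow, norm_pow, Real.norm_eq_abs, Real.norm_eq_abs]
      refine pow_le_pow_left₀ (abs_nonneg _) ?_ _
      rw [abs_of_nonneg (le_max_right h 0)]
      exact max_le (le_abs_self h) (abs_nonneg h)
    refine h1.trans_isLittleO ?_
    simpa using Asymptotics.isLittleO_pow_pow (𝕜 := ℝ) (m := 1) (n := k + 2) (by omega)
  · rw [max_eq_left hs.le]
    have := hasDerivAt_pow (k + 2) s
    push_cast at this
    refine this.congr_of_eventuallyEq ?_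
    filter_upwards [lt_mem_nhds hs] with y hy
    rw [max_eq_left hy.le]

/-- A nonpositive, nondecreasing, concave `C²` function vanishing on `[-1, ∞)`. -/
def cutoff (t : ℝ) : ℝ := -max (-1 - t) 0 ^ 3

/-- The derivative of `cutoff`. -/
def cutoffDeriv (t : ℝ) : ℝ := 3 * max (-1 - t) 0 ^ 2

lemma hasDerivAt_cutoff (t : ℝ) : HasDerivAt cutoff (cutoffDeriv t) t := by
  have := ((hasDerivAt_max_zero_pow 1 (-1 - t)).comp t ((hasDerivAt_id t).const_sub (-1))).neg
  refine this.congr_deriv ?_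
  simp only [cutoffDeriv]; norm_num

lemma hasDerivAt_cutoffDeriv (t : ℝ) : HasDerivAt cutoffDeriv (-6 * max (-1 - t) 0) t := by
  have := ((hasDerivAt_max_zero_pow 0 (-1 - t)).comp t
    ((hasDerivAt_id t).const_sub (-1))).const_mul 3
  refine this.congr_deriv ?_
  norm_num; ring

lemma contDiff_cutoff : ContDiff ℝ 2 cutoff := by
  have h1 : deriv cutoff = cutoffDeriv := funext fun t => (hasDerivAt_cutoff t).deriv
  have h2 : deriv cutoffDeriv = fun t => -6 * max (-1 - t) 0 :=
    funext fun t => (hasDerivAt_cutoffDeriv t).deriv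
  rw [show (2 : WithTop ℕ∞) = 1 + 1 by norm_num, contDiff_succ_iff_deriv]
  refine ⟨fun t => (hasDerivAt_cutoff t).differentiableAt, by simp, ?_⟩
  rw [h1, contDiff_one_iff_deriv, h2]
  exact ⟨fun t => (hasDerivAt_cutoffDeriv t).differentiableAt, by fun_prop⟩

lemma cutoff_nonpos (t : ℝ) : cutoff t ≤ 0 := by
  unfold cutoff; have : 0 ≤ max (-1 - t) 0 ^ 3 := by positivity
  linarith

lemma cutoff_eq_zero {t : ℝ} (ht : -1 ≤ t) : cutoff t = 0 := by
  rw [cutoff, max_eq_right (by linarith)]; norm_num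

lemma cutoffDeriv_nonneg (t : ℝ) : 0 ≤ cutoffDeriv t := by unfold cutoffDeriv; positivity

lemma pd_comp {γ : ℝ → ℝ} {γ' : ℝ} {v : E n → ℝ} {x : E n} (hγ : HasDerivAt γ γ' (v x))
    (hv : DifferentiableAt ℝ v x) (i : Fin n) :
    pd i (fun y => γ (v y)) x = γ' * pd i v x := by
  have h : fderiv ℝ (fun y => γ (v y)) x = _ := (hγ.comp_hasFDerivAt x hv.hasFDerivAt).fderiv
  rw [pd, h]; simp [pd]

lemma hess_cutoff_comp {Ω : Set (E n)} (hΩ : IsOpen Ω) {v : E n → ℝ} (hv : ContDiffOn ℝ 2 v Ω)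
    {x : E n} (hx : x ∈ Ω) (i j : Fin n) :
    hess (fun y => cutoff (v y)) x i j
      = -6 * max (-1 - v x) 0 * (pd i v x * pd j v x) + cutoffDeriv (v x) * hess v x i j := by
  have hd : ∀ y ∈ Ω, DifferentiableAt ℝ v y := fun y hy =>
    (hv.contDiffAt (hΩ.mem_nhds hy)).differentiableAt (by simp)
  have hd2 : DifferentiableAt ℝ (pd i v) x :=
    ((contDiffOn_pd hΩ (k := 1) (by norm_num) hv i).contDiffAt (hΩ.mem_nhds hx)).differentiableAt
      (by simp)
  have h1 : pd j (pd i fun y => cutoff (v y)) x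
      = pd j (fun y => cutoffDeriv (v y) * pd i v y) x := by
    refine pd_congr ?_ j
    filter_upwards [hΩ.mem_nhds hx] with y hy
    exact pd_comp (hasDerivAt_cutoff _) (hd y hy) i
  have h2 : DifferentiableAt ℝ (fun y => cutoffDeriv (v y)) x :=
    ((hasDerivAt_cutoffDeriv (v x)).comp_hasFDerivAt x (hd x hx).hasFDerivAt).differentiableAt
  have h3 : hess v x i j = pd j (pd i v) x := rfl
  rw [h3, hess, Matrix.of_apply, h1, pd_mul h2 hd2, pd_comp (hasDerivAt_cutoffDeriv _) (hd x hx)]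
  ring

lemma pd_sub {a b : E n → ℝ} {x : E n} (ha : DifferentiableAt ℝ a x) (hb : DifferentiableAt ℝ b x)
    (i : Fin n) : pd i (fun y => a y - b y) x = pd i a x - pd i b x := by
  rw [pd, fderiv_fun_sub ha hb]; simp [pd]

lemma hess_sub {Ω : Set (E n)} (hΩ : IsOpen Ω) {a b : E n → ℝ} (ha : ContDiffOn ℝ 2 a Ω)
    (hb : ContDiffOn ℝ 2 b Ω) {x : E n} (hx : x ∈ Ω) :
    hess (fun y => a y - b y) x = hess a x - hess b x := by
  have hd : ∀ {f : E n → ℝ}, ContDiffOn ℝ 1 f Ω → ∀ y ∈ Ω, DifferentiableAt ℝ f y := fun hf y hy =>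
    (hf.contDiffAt (hΩ.mem_nhds hy)).differentiableAt (by simp)
  ext i j
  have h1 : pd j (pd i fun y => a y - b y) x = pd j (fun y => pd i a y - pd i b y) x := by
    refine pd_congr ?_ j
    filter_upwards [hΩ.mem_nhds hx] with y hy
    exact pd_sub (hd (ha.of_le (by norm_num)) y hy) (hd (hb.of_le (by norm_num)) y hy) i
  exact h1.trans (pd_sub (hd (contDiffOn_pd hΩ (by norm_num) ha i) x hx)
    (hd (contDiffOn_pd hΩ (by norm_num) hb i) x hx) j)

lemma hess_half_norm_sq (c : ℝ) (x : E n) :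
    hess (fun y => c / 2 * ‖y‖ ^ 2) x = c • (1 : Matrix (Fin n) (Fin n) ℝ) := by
  have h1 : ∀ i, pd i (fun y : E n => c / 2 * ‖y‖ ^ 2) = fun y => c * y i := by
    intro i; ext y
    have h : fderiv ℝ (fun y : E n => c / 2 * ‖y‖ ^ 2) y = _ :=
      ((hasStrictFDerivAt_norm_sq y).hasFDerivAt.const_mul (c / 2)).fderiv
    rw [pd, h]
    simp [basisVec, EuclideanSpace.inner_single_right]
    ring
  ext i j
  have h2 : HasFDerivAt (fun y : E n => c * y i) (c • (EuclideanSpace.proj i : E n →L[ℝ] ℝ)) x :=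
    (EuclideanSpace.proj i : E n →L[ℝ] ℝ).hasFDerivAt.const_mul c
  rw [hess, Matrix.of_apply, h1, pd, h2.fderiv]
  simp [basisVec, Matrix.one_apply]

/-- The Hessian of a strongly convex function is positive definite. -/
lemma hess_posDef {Ω : Set (E n)} (hΩ : IsOpen Ω) {f : E n → ℝ} (hf : ContDiffOn ℝ 2 f Ω)
    {c : ℝ} (hc : 0 < c) (hconv : StrongConvexOn Ω c f) {x : E n} (hx : x ∈ Ω) :
    (hess f x).PosDef := by
  have hq : ContDiffOn ℝ 2 (fun y : E n => c / 2 * ‖y‖ ^ 2) Ω :=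
    (contDiff_const.mul (contDiff_norm_sq ℝ)).contDiffOn
  have h1 := hess_posSemidef hΩ (hf.sub hq) (strongConvexOn_iff_convex.1 hconv) hx
  have h2 : hess f x = hess (fun y => f y - c / 2 * ‖y‖ ^ 2) x
      + c • (1 : Matrix (Fin n) (Fin n) ℝ) := by
    rw [hess_sub hΩ hf hq hx, hess_half_norm_sq, sub_add_cancel]
  rw [h2]
  exact Matrix.PosDef.posSemidef_add h1 (Matrix.PosDef.one.smul hc)

/-- With `γ = cutoff` and `v = u - p`, `D²γ(v) = γ''(v) Dv ⊗ Dv + γ'(v) (D²u - D²p)`. Against the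
positive semidefinite cofactor matrix of `D²u`, the first term is nonpositive because `γ'' ≤ 0`, the
`D²p` term is nonpositive because `γ' ≥ 0`, and the `D²u` term is exactly `n det(D²u) γ'(v)`. -/
lemma inv_det_mul_sum_cofHess_cutoff_le {Ω : Set (E n)} (hΩ : IsOpen Ω) {u p : E n → ℝ}
    (hu : ContDiffOn ℝ 2 u Ω) (hp : ContDiffOn ℝ 2 p Ω) {x : E n} (hx : x ∈ Ω)
    (hpos : (hess u x).PosDef) (hps : (hess p x).PosSemidef) :
    ((hess u x).det)⁻¹ * ∑ i, ∑ j, cofHess u x i j * hess (fun y => cutoff (u y - p y)) x i j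
      ≤ n * cutoffDeriv (u x - p x) := by
  set v : E n → ℝ := fun y => u y - p y with hv
  have hvc : ContDiffOn ℝ 2 v Ω := hu.sub hp
  have hdet := hpos.det_pos
  have hU : (cofHess u x).PosSemidef := by
    have h1 : cofHess u x = (hess u x).det • (hess u x)⁻¹ := by
      rw [Matrix.inv_def, smul_smul, Ring.inverse_eq_inv', mul_inv_cancel₀ hdet.ne', one_smul,
        cofHess]
    rw [h1]
    exact (hpos.inv.smul hdet).posSemidef
  have hsym : ∀ i j, hess v x i j = hess v x j i := fun i j =>
    pd_comm (hvc.contDiffAt (hΩ.mem_nhds hx)) _ _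
  have h2 : ∑ i, ∑ j, cofHess u x i j * hess v x i j
      = n * (hess u x).det - (cofHess u x * hess p x).trace := by
    have h3 : ∑ i, ∑ j, cofHess u x i j * hess v x i j = (cofHess u x * hess v x).trace := by
      simp only [Matrix.trace, Matrix.diag_apply, Matrix.mul_apply]
      exact Finset.sum_congr rfl fun i _ => Finset.sum_congr rfl fun j _ => by rw [hsym i j]
    rw [h3, hv, hess_sub hΩ hu hp hx, mul_sub, Matrix.trace_sub, cofHess, Matrix.adjugate_mul,
      Matrix.trace_smul, Matrix.trace_one, Fintype.card_fin, smul_eq_mul, mul_comm]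
  have h4 : 0 ≤ ∑ i, ∑ j, cofHess u x i j * (pd i v x * pd j v x) := by
    have := hU.dotProduct_mulVec_nonneg (fun i => pd i v x)
    simp only [dotProduct, Matrix.mulVec, Finset.mul_sum, star_trivial] at this
    refine this.trans_eq (Finset.sum_congr rfl fun i _ => Finset.sum_congr rfl fun j _ => by ring)
  have h5 := trace_mul_nonneg hU hps
  have h6 : ∑ i, ∑ j, cofHess u x i j * hess (fun y => cutoff (v y)) x i j
      = -6 * max (-1 - v x) 0 * ∑ i, ∑ j, cofHess u x i j * (pd i v x * pd j v x)
        + cutoffDeriv (v x) * ∑ i, ∑ j, cofHess u x i j * hess v x i j := by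
    simp only [hess_cutoff_comp hΩ hvc hx, Finset.mul_sum, ← Finset.sum_add_distrib]
    exact Finset.sum_congr rfl fun i _ => Finset.sum_congr rfl fun j _ => by ring
  have h7 : ∑ i, ∑ j, cofHess u x i j * hess (fun y => cutoff (v y)) x i j
      ≤ (hess u x).det * (n * cutoffDeriv (v x)) := by
    rw [h6, h2]
    have h8 : 0 ≤ max (-1 - v x) 0 := le_max_right _ _
    nlinarith [mul_nonneg h8 h4, mul_nonneg (cutoffDeriv_nonneg (v x)) h5]
  rw [inv_mul_le_iff₀ hdet]
  exact h7

/-! ### The Euler–Lagrange term on the inner domain. -/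

lemma gradient_apply (u : E n → ℝ) (x : E n) (j : Fin n) : gradient u x j = pd j u x := by
  have h := InnerProductSpace.toDual_symm_apply (𝕜 := ℝ) (x := basisVec j) (y := fderiv ℝ u x)
  rw [basisVec, EuclideanSpace.inner_single_right] at h
  simpa [gradient, pd, basisVec] using h

lemma norm_gradient (u : E n → ℝ) (x : E n) : ‖gradient u x‖ = ‖fderiv ℝ u x‖ := by
  rw [gradient, LinearIsometryEquiv.norm_map]

/-- The divergence of `F_p(x, u, Du)` by the chain rule. -/
lemma sum_pd_Fp_comp {F : E n → ℝ → E n → ℝ}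
    (hF : ContDiff ℝ ∞ (fun q : E n × ℝ × E n => F q.1 q.2.1 q.2.2)) {Ω : Set (E n)}
    (hΩ : IsOpen Ω) {u : E n → ℝ} (hu : ContDiffOn ℝ 2 u Ω) {x : E n} (hx : x ∈ Ω) :
    ∑ i, pd i (fun y => Fp F i y (u y) (gradient u y)) x
      = ∑ i, Fpx F i x (u x) (gradient u x)
        + ∑ i, Fpz F i x (u x) (gradient u x) * pd i u x
        + (Fpp F x (u x) (gradient u x) * hess u x).trace := by
  set Φ : Fin n → E n × ℝ × E n → ℝ := fun i q => Fp F i q.1 q.2.1 q.2.2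
  have hΦ : ∀ i, ContDiff ℝ ∞ (Φ i) := by
    intro i
    have e : Φ i = fun q => fderiv ℝ (fun q : E n × ℝ × E n => F q.1 q.2.1 q.2.2) q
        (0, 0, basisVec i) := by
      ext q
      have h1 : HasFDerivAt (fun p : E n => (q.1, q.2.1, p))
          ((0 : E n →L[ℝ] E n).prod ((0 : E n →L[ℝ] ℝ).prod (ContinuousLinearMap.id ℝ (E n))))
          q.2.2 :=
        (hasFDerivAt_const q.1 _).prodMk ((hasFDerivAt_const q.2.1 _).prodMk (hasFDerivAt_id _))
      have h2 := ((hF.differentiable (by simp)) (q.1, q.2.1, q.2.2)).hasFDerivAt.comp q.2.2 h1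
      have h3 : fderiv ℝ (fun p => F q.1 q.2.1 p) q.2.2 = _ := h2.fderiv
      simp only [Φ, Fp, pd, h3]
      simp
    rw [e]
    exact (hF.fderiv_right (m := ∞) (by simp)).clm_apply contDiff_const
  have hud : DifferentiableAt ℝ u x :=
    (hu.contDiffAt (hΩ.mem_nhds hx)).differentiableAt (by simp)
  have hpdd : ∀ j, DifferentiableAt ℝ (pd j u) x := fun j =>
    ((contDiffOn_pd hΩ (k := 1) (by norm_num) hu j).contDiffAt (hΩ.mem_nhds hx)).differentiableAt
      (by simp)
  have hgd : DifferentiableAt ℝ (gradient u) x := by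
    rw [differentiableAt_euclidean]
    intro j
    simpa only [gradient_apply] using hpdd j
  have hgi : ∀ i j, fderiv ℝ (gradient u) x (basisVec i) j = hess u x j i := by
    intro i j
    have h1 := (EuclideanSpace.proj j : E n →L[ℝ] ℝ).hasFDerivAt.comp x hgd.hasFDerivAt
    have h2 : (⇑(EuclideanSpace.proj j : E n →L[ℝ] ℝ) ∘ gradient u) = pd j u :=
      funext fun y => gradient_apply u y j
    rw [h2] at h1
    rw [hess, Matrix.of_apply, pd, h1.fderiv]
    rfl
  have key : ∀ i, pd i (fun y => Fp F i y (u y) (gradient u y)) x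
      = Fpx F i x (u x) (gradient u x) + Fpz F i x (u x) (gradient u x) * pd i u x
        + ∑ j, Fpp F x (u x) (gradient u x) i j * hess u x j i := by
    intro i
    set X : E n × ℝ × E n := (x, u x, gradient u x)
    have hD := ((hΦ i).differentiable (by simp) X).hasFDerivAt
    have h1 : HasFDerivAt (fun y => (y, u y, gradient u y))
        ((ContinuousLinearMap.id ℝ (E n)).prod ((fderiv ℝ u x).prod (fderiv ℝ (gradient u) x))) x :=
      (hasFDerivAt_id x).prodMk (hud.hasFDerivAt.prodMk hgd.hasFDerivAt)
    have h2 : fderiv ℝ (fun y => Fp F i y (u y) (gradient u y)) x = _ :=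
      (HasFDerivAt.comp (g := Φ i) (f := fun y => (y, u y, gradient u y)) x hD h1).fderiv
    have hx1 : Fpx F i x (u x) (gradient u x) = fderiv ℝ (Φ i) X (basisVec i, 0, 0) := by
      have h3 : HasFDerivAt (fun y : E n => (y, u x, gradient u x))
          ((ContinuousLinearMap.id ℝ (E n)).prod ((0 : E n →L[ℝ] ℝ).prod (0 : E n →L[ℝ] E n))) x :=
        (hasFDerivAt_id x).prodMk ((hasFDerivAt_const _ _).prodMk (hasFDerivAt_const _ _))
      have h4 : fderiv ℝ (fun y => Fp F i y (u x) (gradient u x)) x = _ :=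
        (HasFDerivAt.comp (g := Φ i) (f := fun y => (y, u x, gradient u x)) x hD h3).fderiv
      rw [Fpx, pd, h4]; simp
    have hx2 : Fpz F i x (u x) (gradient u x) = fderiv ℝ (Φ i) X (0, 1, 0) := by
      have h3 : HasDerivAt (fun t : ℝ => (x, t, gradient u x)) ((0 : E n), (1 : ℝ), (0 : E n)) (u x) :=
        (hasDerivAt_const _ _).prodMk ((hasDerivAt_id _).prodMk (hasDerivAt_const _ _))
      exact (hD.comp_hasDerivAt (u x) h3).deriv
    have hx3 : ∀ h : E n, fderiv ℝ (Φ i) X (0, 0, h)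
        = ∑ j, Fpp F x (u x) (gradient u x) i j * h j := by
      intro h
      have h3 : HasFDerivAt (fun p : E n => (x, u x, p))
          ((0 : E n →L[ℝ] E n).prod ((0 : E n →L[ℝ] ℝ).prod (ContinuousLinearMap.id ℝ (E n))))
          (gradient u x) :=
        (hasFDerivAt_const _ _).prodMk ((hasFDerivAt_const _ _).prodMk (hasFDerivAt_id _))
      have h4 : fderiv ℝ (fun p => Fp F i x (u x) p) (gradient u x) = _ :=
        (HasFDerivAt.comp (g := Φ i) (f := fun p => (x, u x, p)) (gradient u x) hD h3).fderiv
      have h5 := fderiv_apply_eq_sum_pd (fun p => Fp F i x (u x) p) (gradient u x) h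
      rw [h4] at h5
      simp only [Fpp, Matrix.of_apply]
      refine Eq.trans ?_ (h5.trans (Finset.sum_congr rfl fun j _ => mul_comm _ _))
      simp
    rw [pd, h2, hx1, hx2]
    simp only [← hgi, ← hx3]
    rw [mul_comm, ← smul_eq_mul, ← map_smul, ← map_add, ← map_add]
    simp [pd]
  simp only [key, Finset.sum_add_distrib]
  rfl

/-- On `Ω₀` the Euler–Lagrange expression, tested with a nonpositive number, is bounded below. -/
lemma mul_le_eulerLagrange_mul (hn : 0 < n) {Ω Ω₀ : Set (E n)} {f g : Fin 4 → ℝ → ℝ}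
    (hf : ∀ k, IsGrowthFunction (f k)) (hg : ∀ k, IsGrowthFunction (g k))
    {F : E n → ℝ → E n → ℝ} (hF : IsAdmissibleLagrangian Ω₀ f g F) (hΩ : IsOpen Ω) {u : E n → ℝ}
    (hu : ContDiffOn ℝ 2 u Ω) {x : E n} (hx : x ∈ Ω) (hx₀ : x ∈ Ω₀) (hpos : (hess u x).PosSemidef)
    {R : ℝ} (huR : |u x| ≤ R) (hgR : ‖gradient u x‖ ≤ R) {γ : ℝ} (hγ : γ ≤ 0) :
    (f 0 R * g 0 R + f 2 R * g 2 R + n * (R * (f 3 R * g 3 R))) * γ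
      ≤ (Fz F x (u x) (gradient u x)
        - ∑ i : Fin n, pd i (fun y => Fp F i y (u y) (gradient u y)) x) * γ := by
  have hmon : ∀ k, f k |u x| * g k ‖gradient u x‖ ≤ f k R * g k R := fun k => by
    have h0 := abs_nonneg (u x)
    have h1 := norm_nonneg (gradient u x)
    exact mul_le_mul ((hf k).mono h0 (h0.trans huR) huR) ((hg k).mono h1 (h1.trans hgR) hgR)
      ((hg k).nonneg _ h1) ((hf k).nonneg _ (h0.trans huR))
  have hR : 0 ≤ R := (abs_nonneg _).trans huR
  have hz : Fz F x (u x) (gradient u x) ≤ f 0 R * g 0 R := by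
    -- Any index would do; positivity of the dimension is what makes one available.
    have := hF.bound_first x hx₀ (u x) (gradient u x) ⟨0, hn⟩
    linarith [le_abs_self (Fz F x (u x) (gradient u x)), hmon 0,
      abs_nonneg (Fp F ⟨0, hn⟩ x (u x) (gradient u x))]
  have hpx : -∑ i, Fpx F i x (u x) (gradient u x) ≤ f 2 R * g 2 R :=
    (neg_le_abs _).trans ((hF.bound_px x hx₀ _ _).trans (hmon 2))
  have hpz : -∑ i, Fpz F i x (u x) (gradient u x) * pd i u x
      ≤ n * (R * (f 3 R * g 3 R)) := by
    rw [← Finset.sum_neg_distrib]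
    have : ∀ i ∈ Finset.univ, -(Fpz F i x (u x) (gradient u x) * pd i u x)
        ≤ R * (f 3 R * g 3 R) := fun i _ => by
      refine (neg_le_abs _).trans ?_
      rw [abs_mul, mul_comm]
      refine mul_le_mul ?_ ((hF.bound_pz x hx₀ _ _ i).trans (hmon 3)) (abs_nonneg _) hR
      rw [← gradient_apply]
      exact (PiLp.norm_apply_le _ i).trans hgR
    refine (Finset.sum_le_sum this).trans_eq ?_
    simp
  -- The second-order part `tr(F_pp D²u)` enters with a minus sign and is dropped instead of
  -- estimated, so no bound on `D²u` is needed.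
  have htr := trace_mul_nonneg (hF.bound_pp_lower x hx₀ (u x) (gradient u x)) hpos
  refine mul_le_mul_of_nonpos_right ?_ hγ
  rw [sum_pd_Fp_comp hF.smooth hΩ hu hx]
  linarith

/-- A convex function bounded by `B` on a ball of radius `d` is Lipschitz on the concentric half
ball with constant `2B / (d/2)`. -/
lemma norm_gradient_le {Ω : Set (E n)} {u : E n → ℝ} (hu : ConvexOn ℝ Ω u) {x : E n} {d : ℝ}
    (hd : 0 < d) (hball : Metric.ball x d ⊆ Ω) {B : ℝ} (hB : ∀ y ∈ Ω, |u y| ≤ B) :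
    ‖gradient u x‖ ≤ 4 * B / d := by
  have hB0 : 0 ≤ B := (abs_nonneg _).trans (hB x (hball (Metric.mem_ball_self hd)))
  have h1 := (hu.subset hball (convex_ball x d)).lipschitzOnWith_of_abs_le (half_pos hd)
    fun a ha => hB a (hball ha)
  have h2 := norm_fderiv_le_of_lipschitzOn ℝ (Metric.ball_mem_nhds x (by linarith)) h1
  rw [norm_gradient]
  refine h2.trans_eq ?_
  rw [Real.coe_toNNReal _ (by positivity)]
  field_simp; ring

/-! ### Growth of the penalization. -/

lemma continuousOn_H {f g : Fin 4 → ℝ → ℝ} (hf : ∀ k, IsGrowthFunction (f k))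
    (hg : ∀ k, IsGrowthFunction (g k)) : ContinuousOn (H f g) (Ici 0) := by
  have h1 := fun k => (hf k).smooth.continuousOn
  have h2 := fun k => (hg k).smooth.continuousOn
  unfold H
  have i0 := h1 0; have i2 := h1 2; have i3 := h1 3
  have j0 := h2 0; have j2 := h2 2; have j3 := h2 3
  fun_prop

lemma H_mono {f g : Fin 4 → ℝ → ℝ} (hf : ∀ k, IsGrowthFunction (f k))
    (hg : ∀ k, IsGrowthFunction (g k)) {a b : ℝ} (ha : 0 ≤ a) (hab : a ≤ b) :
    H f g a ≤ H f g b := by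
  have hb : 0 ≤ b := ha.trans hab
  have hm : ∀ k, f k a * g k a ≤ f k b * g k b := fun k =>
    mul_le_mul ((hf k).mono ha hb hab) ((hg k).mono ha hb hab) ((hg k).nonneg _ ha)
      ((hf k).nonneg _ hb)
  have h0 : ∀ k, 0 ≤ f k a * g k a := fun k => mul_nonneg ((hf k).nonneg _ ha) ((hg k).nonneg _ ha)
  have := h0 0; have := h0 2; have := h0 3
  unfold H
  gcongr ?_ * (1 + ?_ + ?_ + ?_ * ?_)
  · exact hm 0
  · exact hm 2
  · exact hm 3

lemma le_H {f g : Fin 4 → ℝ → ℝ} (hf : ∀ k, IsGrowthFunction (f k))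
    (hg : ∀ k, IsGrowthFunction (g k)) {a : ℝ} (ha : 0 ≤ a) : a ≤ H f g a := by
  have h0 : ∀ k, 0 ≤ f k a * g k a := fun k => mul_nonneg ((hf k).nonneg _ ha) ((hg k).nonneg _ ha)
  unfold H
  refine le_mul_of_one_le_right ha ?_
  have := mul_nonneg ha (h0 3)
  linarith [h0 0, h0 2]

/-- The growth functions are controlled only on `[0, ∞)`, so the fundamental theorem is applied at
the interior point `t² > 0`; the tested values `t < -1` satisfy this. -/
lemma deriv_G {f g : Fin 4 → ℝ → ℝ} (hf : ∀ k, IsGrowthFunction (f k))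
    (hg : ∀ k, IsGrowthFunction (g k)) {t : ℝ} (ht : t ≠ 0) :
    deriv (G f g) t = 2 * t * H f g (t ^ 2) := by
  have hc := continuousOn_H hf hg
  have hpos : 0 < t ^ 2 := by positivity
  have h1 : HasDerivAt (fun y => ∫ s in (0 : ℝ)..y, H f g s) (H f g (t ^ 2)) (t ^ 2) := by
    refine intervalIntegral.integral_hasDerivAt_right ?_ ?_ ?_
    · refine (hc.mono ?_).intervalIntegrable
      rw [uIcc_of_le hpos.le]
      exact fun y hy => hy.1
    · exact (hc.mono Ioi_subset_Ici_self).stronglyMeasurableAtFilter isOpen_Ioi _ hpos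
    · exact hc.continuousAt (Ici_mem_nhds hpos)
  have h2 : HasDerivAt (fun y : ℝ => y ^ 2) (2 * t) t := by simpa using hasDerivAt_pow 2 t
  have h3 : deriv (G f g) t = _ :=
    (HasDerivAt.comp (h₂ := fun y => ∫ s in (0 : ℝ)..y, H f g s) (h := fun y : ℝ => y ^ 2) t
      h1 h2).deriv
  rw [h3]; ring

/-- Where the cutoff is nonzero, `t < -1` and both factors are nonpositive. The penalization is
therefore never harmful, even off the set where it is used. -/
lemma deriv_G_mul_cutoff_nonneg {f g : Fin 4 → ℝ → ℝ} (hf : ∀ k, IsGrowthFunction (f k))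
    (hg : ∀ k, IsGrowthFunction (g k)) (t : ℝ) : 0 ≤ deriv (G f g) t * cutoff t := by
  rcases le_or_gt (-1) t with h | h
  · rw [cutoff_eq_zero h, mul_zero]
  · rw [deriv_G hf hg (by linarith)]
    have h1 := le_H hf hg (sq_nonneg t)
    refine mul_nonneg_of_nonpos_of_nonpos ?_ (cutoff_nonpos t)
    exact mul_nonpos_of_nonpos_of_nonneg (by linarith) ((sq_nonneg t).trans h1)

lemma le_deriv_G_mul_cutoff {f g : Fin 4 → ℝ → ℝ} (hf : ∀ k, IsGrowthFunction (f k))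
    (hg : ∀ k, IsGrowthFunction (g k)) {m t : ℝ} (hm : 2 ≤ m) (ht : t ≤ -m) :
    m ^ 4 * H f g (m ^ 2) / 4 ≤ deriv (G f g) t * cutoff t := by
  rw [deriv_G hf hg (by linarith), cutoff, max_eq_left (by linarith)]
  have h1 : H f g (m ^ 2) ≤ H f g (t ^ 2) := H_mono hf hg (sq_nonneg m) (by nlinarith)
  have h0 : 0 ≤ H f g (m ^ 2) := (sq_nonneg m).trans (le_H hf hg (sq_nonneg m))
  -- Here `-1 - t ≥ m - 1 ≥ m / 2`, which is where `m ≥ 2` enters.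
  have h2 : (m / 2) ^ 3 ≤ (-1 - t) ^ 3 := pow_le_pow_left₀ (by linarith) (by linarith) 3
  calc m ^ 4 * H f g (m ^ 2) / 4 = 2 * m * H f g (m ^ 2) * (m / 2) ^ 3 := by ring
    _ ≤ 2 * (-t) * H f g (t ^ 2) * (-1 - t) ^ 3 := by
        gcongr
        · exact mul_nonneg (by linarith) (h0.trans h1)
        · linarith
        · exact le_neg_of_le_neg ht
    _ = _ := by ring

/-! ### The perturbed boundary datum, the maximum principle and the geometry of the domains. -/

lemma IsUniformlyConvexDefiningFunction.nonpos {Ω : Set (E n)} {ρ : E n → ℝ}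
    (hρ : IsUniformlyConvexDefiningFunction Ω ρ) (hΩ : IsOpen Ω) {x : E n} (hx : x ∈ closure Ω) :
    ρ x ≤ 0 := by
  by_cases h : x ∈ Ω
  · rw [← hρ.neg_iff] at h; exact le_of_lt h
  · exact (hρ.eq_zero x (by rw [hΩ.frontier_eq]; exact ⟨hx, h⟩)).le

lemma ConvexOn.exp_comp {s : Set (E n)} {ρ : E n → ℝ} (h : ConvexOn ℝ s ρ) :
    ConvexOn ℝ s fun x => Real.exp (ρ x) :=
  ⟨h.1, fun _ hx _ hy _ _ ha hb hab =>
    (Real.exp_le_exp.2 (h.2 hx hy ha hb hab)).trans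
      (convexOn_exp.2 (mem_univ _) (mem_univ _) ha hb hab)⟩

lemma convexOn_phiTilde {Ω : Set (E n)} {φ ρ : E n → ℝ} (hφ : ConvexOn ℝ (closure Ω) φ)
    (hρ : IsUniformlyConvexDefiningFunction Ω ρ) (hconv : Convex ℝ Ω) {ε : ℝ} (hε : 0 ≤ ε) :
    ConvexOn ℝ Ω (phiTilde φ ρ ε) := by
  obtain ⟨m, hm, hsc⟩ := hρ.uniformly_convex
  have h1 : ConvexOn ℝ Ω ρ := (UniformConvexOn.convexOn hsc fun r => by simp only [Pi.zero_apply]; positivity).subset subset_closure hconv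
  have h2 : ConvexOn ℝ Ω fun x => Real.exp (ρ x) - 1 := (ConvexOn.exp_comp h1).sub
    (concaveOn_const 1 hconv)
  exact (hφ.subset subset_closure hconv).add (h2.smul (Real.rpow_nonneg hε _))

lemma contDiffOn_phiTilde {Ω : Set (E n)} {φ ρ : E n → ℝ} {k : ℕ} (hφ : ContDiffOn ℝ k φ Ω)
    (hρ : ContDiff ℝ ∞ ρ) (ε : ℝ) : ContDiffOn ℝ k (phiTilde φ ρ ε) Ω := by
  have h : ContDiff ℝ k ρ := hρ.of_le (by exact_mod_cast le_top)
  unfold phiTilde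
  exact hφ.add (contDiff_const.mul (h.exp.sub contDiff_const)).contDiffOn

lemma abs_phiTilde_le {Ω : Set (E n)} {φ ρ : E n → ℝ} (hΩ : IsOpen Ω)
    (hρ : IsUniformlyConvexDefiningFunction Ω ρ) {A ε : ℝ} (hA : ∀ x ∈ closure Ω, |φ x| ≤ A)
    (hε : 0 ≤ ε) (hε1 : ε ≤ 1) {x : E n} (hx : x ∈ closure Ω) :
    |phiTilde φ ρ ε x| ≤ A + 1 := by
  have h1 : ε ^ (1 / (3 * (n : ℝ) ^ 2)) ≤ 1 := Real.rpow_le_one hε hε1 (by positivity)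
  have h0 : 0 ≤ ε ^ (1 / (3 * (n : ℝ) ^ 2)) := Real.rpow_nonneg hε _
  have h2 : Real.exp (ρ x) ≤ 1 := Real.exp_le_one_iff.2 (hρ.nonpos hΩ hx)
  have h3 := Real.exp_pos (ρ x)
  refine (abs_add_le _ _).trans (add_le_add (hA x hx) ?_)
  rw [abs_mul, abs_of_nonneg h0]
  exact mul_le_one₀ h1 (abs_nonneg _) (by rw [abs_le]; constructor <;> linarith)

lemma phiTilde_frontier {Ω : Set (E n)} {φ ρ : E n → ℝ}
    (hρ : IsUniformlyConvexDefiningFunction Ω ρ) (ε : ℝ) {x : E n} (hx : x ∈ frontier Ω) :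
    phiTilde φ ρ ε x = φ x := by
  simp [phiTilde, hρ.eq_zero x hx]

/-- A strictly convex function is bounded above by its boundary values. -/
lemma le_of_strictConvexOn [Nontrivial (E n)] {Ω : Set (E n)} (hΩ : IsOpen Ω)
    (hb : Bornology.IsBounded Ω) {u : E n → ℝ} (hu : ContinuousOn u (closure Ω))
    (hc : StrictConvexOn ℝ Ω u) {A : ℝ} (hA : ∀ x ∈ frontier Ω, u x ≤ A) {x : E n}
    (hx : x ∈ closure Ω) : u x ≤ A := by
  obtain ⟨z, hz, hmax⟩ := hb.isCompact_closure.exists_isMaxOn ⟨x, hx⟩ hu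
  refine (hmax hx).trans (hA z ?_)
  rw [hΩ.frontier_eq]
  refine ⟨hz, fun hzΩ => ?_⟩
  obtain ⟨r, hr, hrΩ⟩ := Metric.isOpen_iff.1 hΩ z hzΩ
  obtain ⟨h, hh⟩ := exists_norm_eq (E n) (half_pos hr).le
  have hne : h ≠ 0 := fun h0 => by rw [h0, norm_zero] at hh; linarith
  have h1 : z + h ∈ Ω := hrΩ (by rw [mem_ball_iff_norm]; simp [hh]; linarith)
  have h2 : z - h ∈ Ω := hrΩ (by rw [mem_ball_iff_norm]; simp [hh]; linarith)
  have hne' : z + h ≠ z - h := fun he => hne <| by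
    calc h = (1 / 2 : ℝ) • ((z + h) - (z - h)) := by module
      _ = 0 := by rw [he, sub_self, smul_zero]
  have h3 := hc.2 h1 h2 hne' (by norm_num : (0 : ℝ) < 1 / 2) (by norm_num : (0 : ℝ) < 1 / 2)
    (by norm_num)
  have h4 : (1 / 2 : ℝ) • (z + h) + (1 / 2 : ℝ) • (z - h) = z := by module
  rw [h4, smul_eq_mul, smul_eq_mul] at h3
  have h5 : u (z + h) ≤ u z := hmax (subset_closure h1)
  have h6 : u (z - h) ≤ u z := hmax (subset_closure h2)
  linarith

/-- The open set `Ω \ closure Ω₀` is nonempty, since otherwise `Ω` would be clopen, hence empty or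
the whole space; so it has positive measure. -/
lemma measureReal_lt_of_closure_subset [Nontrivial (E n)] {Ω Ω₀ : Set (E n)} (hΩ : IsOpen Ω)
    (hne : Ω.Nonempty) (hb : Bornology.IsBounded Ω) (hΩ₀ : closure Ω₀ ⊆ Ω) :
    volume.real Ω₀ < volume.real Ω := by
  have hK : IsCompact (closure Ω₀) :=
    (hb.subset (subset_closure.trans hΩ₀)).isCompact_closure
  have hopen : IsOpen (Ω \ closure Ω₀) := hΩ.sdiff isClosed_closure
  have hne' : (Ω \ closure Ω₀).Nonempty := by
    by_contra h
    rw [not_nonempty_iff_eq_empty, sdiff_eq_empty] at h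
    have hcl : IsClosed Ω := by rw [← hΩ₀.antisymm h]; exact isClosed_closure
    rcases isClopen_iff.1 ⟨hcl, hΩ⟩ with h | h
    · exact hne.ne_empty h
    · rw [h] at hb; exact NormedSpace.unbounded_univ ℝ (E n) hb
  have hfin : volume Ω ≠ ⊤ := hb.measure_lt_top.ne
  have h1 : 0 < volume.real (Ω \ closure Ω₀) :=
    ENNReal.toReal_pos (hopen.measure_pos volume hne').ne'
      (measure_ne_top_of_subset sdiff_subset hfin)
  have h2 := measureReal_sdiff_add_inter (μ := volume) (s := Ω)
    (isClosed_closure (s := Ω₀)).measurableSet hfin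
  rw [inter_eq_self_of_subset_right hΩ₀] at h2
  have h3 : volume.real Ω₀ ≤ volume.real (closure Ω₀) :=
    measureReal_mono subset_closure (measure_ne_top_of_subset hΩ₀ hfin)
  linarith

lemma exists_contraction_factor {a b : ℝ} (hab : a < b) (n : ℕ) :
    ∃ τ : ℝ, 0 < τ ∧ τ < 1 ∧ a < τ ^ n * b := by
  have h : Tendsto (fun τ : ℝ => τ ^ n * b) (𝓝[<] 1) (𝓝 (1 ^ n * b)) :=
    (((continuous_pow n).mul continuous_const).tendsto 1).mono_left nhdsWithin_le_nhds
  rw [one_pow, one_mul] at h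
  obtain ⟨τ, h1, h2, h3⟩ := ((h.eventually (lt_mem_nhds hab)).and
    ((eventually_nhdsWithin_of_eventually_nhds (lt_mem_nhds one_pos)).and
      self_mem_nhdsWithin)).exists
  exact ⟨τ, h2, h3, h1⟩

/-! ### The energy argument for the lower bound. -/

/-- The arithmetic that closes the argument, with `h = H(m²)`. After multiplication by `ε < 1` the
left side is of order `m⁴ h`, while `V ≤ c m` and `m² T ≤ N h` bound everything else by order `m³
h`; dividing by `m³ h` leaves a bound on `m`. -/
lemma le_of_energy {ε m h T V c N p q μ₀ μ : ℝ} (hε : 0 < ε) (hε1 : ε < 1) (hm : 1 ≤ m)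
    (hmh : m ^ 2 ≤ h) (hT : 0 ≤ T) (hTh : m ^ 2 * T ≤ N * h) (hV : 0 ≤ V) (hVm : V ≤ c * m)
    (hN : 0 ≤ N) (hp : 0 ≤ p) (hq : 0 ≤ q) (hμ₀ : 0 < μ₀) (hμ : μ₀ ≤ μ)
    (key : m ^ 4 * h / 4 / ε * μ - T * V ^ 3 * q ≤ ε * (N * (3 * V ^ 2) * p)) :
    m ≤ 4 * N * (3 * c ^ 2 * p + c ^ 3 * q) / μ₀ := by
  have hm0 : 0 < m := by linarith
  have hc : 0 ≤ c := by
    by_contra hc; push Not at hc; nlinarith [mul_neg_of_neg_of_pos hc hm0]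
  have hh : 1 ≤ h := by nlinarith
  have h1 : m ^ 4 * h / 4 * μ ≤ ε * (T * V ^ 3 * q) + ε * ε * (N * (3 * V ^ 2) * p) := by
    have e : m ^ 4 * h / 4 * μ = ε * (m ^ 4 * h / 4 / ε * μ) := by field_simp
    rw [e]
    nlinarith
  have h2 : ε * (T * V ^ 3 * q) ≤ T * V ^ 3 * q :=
    mul_le_of_le_one_left (by positivity) hε1.le
  have h3 : ε * ε * (N * (3 * V ^ 2) * p) ≤ N * (3 * V ^ 2) * p :=
    mul_le_of_le_one_left (by positivity) (by nlinarith)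
  have h4 : m ^ 4 * h / 4 * μ₀ ≤ m ^ 4 * h / 4 * μ := by gcongr
  have h5 : T * V ^ 3 * q ≤ T * (c * m) ^ 3 * q := by gcongr
  have h6 : N * (3 * V ^ 2) * p ≤ N * (3 * (c * m) ^ 2) * p := by gcongr
  have h7 : T * (c * m) ^ 3 * q ≤ N * h * (c ^ 3 * m * q) := by
    calc T * (c * m) ^ 3 * q = m ^ 2 * T * (c ^ 3 * m * q) := by ring
      _ ≤ _ := by gcongr
  have h8 : N * h * (c ^ 3 * m * q) ≤ N * h * (c ^ 3 * m ^ 3 * q) := by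
    gcongr; exact le_self_pow₀ hm (by norm_num)
  have h9 : N * (3 * (c * m) ^ 2) * p ≤ N * h * (3 * c ^ 2 * m ^ 3 * p) := by
    calc N * (3 * (c * m) ^ 2) * p = N * 1 * (3 * c ^ 2 * m ^ 2 * p) := by ring
      _ ≤ _ := by gcongr; norm_num
  rw [le_div_iff₀ hμ₀]
  have h10 : m ^ 3 * h * (m * μ₀) ≤ m ^ 3 * h * (4 * N * (3 * c ^ 2 * p + c ^ 3 * q)) := by
    nlinarith
  exact le_of_mul_le_mul_left h10 (by positivity)

/-- Testing the equation with `cutoff (u - φ̃)`. -/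
lemma IsSolution.integral_rhs_mul_cutoff_le {Ω Ω₀ : Set (E n)} {φ ψ ρ : E n → ℝ}
    {f g : Fin 4 → ℝ → ℝ} {F : E n → ℝ → E n → ℝ} {s ε : ℝ} {u w : E n → ℝ}
    (h : IsSolution Ω Ω₀ φ ψ ρ f g F s ε u w) (hΩ : IsOpen Ω) (hb : Bornology.IsBounded Ω)
    (hconv : Convex ℝ Ω) (hρ : IsUniformlyConvexDefiningFunction Ω ρ)
    (hφ : ContDiffOn ℝ 2 φ Ω) (hφc : ContinuousOn φ (closure Ω)) (hφconv : ConvexOn ℝ (closure Ω) φ)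
    (hu : ContDiffOn ℝ 3 u Ω) (hε : 0 ≤ ε) {V : ℝ}
    (hV : ∀ x ∈ Ω, |u x - phiTilde φ ρ ε x| ≤ V) :
    IntegrableOn (fun x => rhs Ω Ω₀ φ ρ f g F ε u x * cutoff (u x - phiTilde φ ρ ε x)) Ω ∧
    ∫ x in Ω, rhs Ω Ω₀ φ ρ f g F ε u x * cutoff (u x - phiTilde φ ρ ε x)
      ≤ ε * (n * (3 * V ^ 2) * volume.real Ω) := by
  obtain ⟨c, hc, hsc⟩ := h.uniformly_convex
  obtain ⟨w₁, w₂, h₁, h₂, heq⟩ := h.equation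
  set p := phiTilde φ ρ ε with hp
  have hpC : ContDiffOn ℝ 2 p Ω := contDiffOn_phiTilde (k := 2) (by exact_mod_cast hφ) hρ.smooth ε
  have hpc : ContinuousOn p (closure Ω) := by
    have := hρ.smooth.continuous
    rw [hp]; unfold phiTilde
    fun_prop
  have hu2 : ContDiffOn ℝ 2 u Ω := hu.of_le (by norm_num)
  -- The cutoff is flat up to `-1`, not just `0`: this closed sublevel set misses the boundary,
  -- where `u - p = 0`, and is thus a compact subset of `Ω` carrying the test function.
  set K := closure Ω ∩ (fun x => u x - p x) ⁻¹' Iic (-1) with hK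
  have hKcl : IsClosed K :=
    (h.continuousOn_u.sub hpc).preimage_isClosed_of_isClosed isClosed_closure isClosed_Iic
  have hKc : IsCompact K := hb.isCompact_closure.of_isClosed_subset hKcl inter_subset_left
  have hKΩ : K ⊆ Ω := by
    intro x hx
    by_contra hxΩ
    have hxf : x ∈ frontier Ω := by rw [hΩ.frontier_eq]; exact ⟨hx.1, hxΩ⟩
    have h1 : u x - p x ≤ -1 := hx.2
    rw [h.u_boundary x hxf, hp, phiTilde_frontier hρ ε hxf, sub_self] at h1
    linarith
  set η := Ω.indicator fun x => cutoff (u x - p x) with hη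
  have hηΩ : ∀ x ∈ Ω, η x = cutoff (u x - p x) := fun x hx => indicator_of_mem hx _
  have hηC : ContDiffOn ℝ 2 η Ω := (contDiff_cutoff.comp_contDiffOn (hu2.sub hpC)).congr hηΩ
  have hη0 : ∀ x, x ∉ K → η x = 0 := by
    intro x hx
    by_cases hxΩ : x ∈ Ω
    · rw [hηΩ x hxΩ]
      refine cutoff_eq_zero (le_of_lt (not_le.1 fun hle => hx ⟨subset_closure hxΩ, hle⟩))
    · exact indicator_of_notMem hxΩ _
  have hpos : ∀ x ∈ Ω, (hess u x).PosDef := fun x hx => hess_posDef hΩ hu2 hc hsc hx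
  obtain ⟨i1, i2, hid⟩ := integral_cofHess_mul hΩ hKc hKΩ hu (fun x hx => (hpos x hx).det_pos.ne')
    h₁ h₂ hηC hη0
  have hae : (fun x => ε * ((∑ i, ∑ j, cofHess u x i j * w₂ i j x) * η x))
      =ᵐ[volume.restrict Ω] fun x => rhs Ω Ω₀ φ ρ f g F ε u x * cutoff (u x - p x) := by
    filter_upwards [heq, ae_restrict_mem hΩ.measurableSet] with x hx hxΩ
    rw [← hx, hηΩ x hxΩ]; ring
  refine ⟨(i1.const_mul ε).congr hae, ?_⟩
  rw [← integral_congr_ae hae, integral_const_mul, hid]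
  refine mul_le_mul_of_nonneg_left ?_ hε
  have hle : ∀ x ∈ Ω, w x * ∑ i, ∑ j, cofHess u x i j * hess η x i j ≤ n * (3 * V ^ 2) := by
    intro x hx
    have hps := hess_posSemidef hΩ hpC (convexOn_phiTilde hφconv hρ hconv hε) hx
    have e : hess η x = hess (fun y => cutoff (u y - p y)) x := by
      ext i j
      refine pd_congr ?_ j
      filter_upwards [hΩ.mem_nhds hx] with y hy
      refine pd_congr ?_ i
      filter_upwards [hΩ.mem_nhds hy] with z hz using hηΩ z hz
    rw [h.w_eq x hx, e]
    refine (inv_det_mul_sum_cofHess_cutoff_le hΩ hu2 hpC hx (hpos x hx) hps).trans ?_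
    rw [cutoffDeriv]
    gcongr
    have h1 := neg_le_of_abs_le (hV x hx)
    exact max_le (by linarith) ((abs_nonneg _).trans (hV x hx))
  have hfin : volume Ω ≠ ⊤ := hb.measure_lt_top.ne
  have := setIntegral_mono_on i2 (integrableOn_const hfin) hΩ.measurableSet hle
  refine this.trans_eq ?_
  rw [setIntegral_const, smul_eq_mul, mul_comm]

/-- The lower bound for the tested right-hand side, when `u - φ̃ ≤ -m` on a set outside `Ω₀`. -/
lemma le_integral_rhs_mul_cutoff (hn : 0 < n) {Ω Ω₀ S : Set (E n)} {φ ρ : E n → ℝ}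
    {f g : Fin 4 → ℝ → ℝ} (hf : ∀ k, IsGrowthFunction (f k)) (hg : ∀ k, IsGrowthFunction (g k))
    {F : E n → ℝ → E n → ℝ} (hF : IsAdmissibleLagrangian Ω₀ f g F) {ε : ℝ} {u : E n → ℝ}
    (hΩ : IsOpen Ω) (hb : Bornology.IsBounded Ω) (hΩ₀ : MeasurableSet Ω₀) (hΩ₀Ω : Ω₀ ⊆ Ω)
    (hS : MeasurableSet S) (hSΩ : S ⊆ Ω \ Ω₀) (hu : ContDiffOn ℝ 2 u Ω)
    (hpos : ∀ x ∈ Ω, (hess u x).PosSemidef) (hε : 0 < ε) {V R m : ℝ}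
    (hV : ∀ x ∈ Ω, |u x - phiTilde φ ρ ε x| ≤ V) (hm : 2 ≤ m)
    (huS : ∀ x ∈ S, u x - phiTilde φ ρ ε x ≤ -m)
    (huR : ∀ x ∈ Ω₀, |u x| ≤ R) (hgR : ∀ x ∈ Ω₀, ‖gradient u x‖ ≤ R) (hR : 0 ≤ R)
    (hi : IntegrableOn
      (fun x => rhs Ω Ω₀ φ ρ f g F ε u x * cutoff (u x - phiTilde φ ρ ε x)) Ω) :
    m ^ 4 * H f g (m ^ 2) / 4 / ε * volume.real S
        - (f 0 R * g 0 R + f 2 R * g 2 R + n * (R * (f 3 R * g 3 R))) * V ^ 3 * volume.real Ω₀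
      ≤ ∫ x in Ω, rhs Ω Ω₀ φ ρ f g F ε u x * cutoff (u x - phiTilde φ ρ ε x) := by
  set p := phiTilde φ ρ ε with hp
  set T := f 0 R * g 0 R + f 2 R * g 2 R + n * (R * (f 3 R * g 3 R)) with hT
  set a := m ^ 4 * H f g (m ^ 2) / 4 / ε with ha
  have hfg : ∀ k, 0 ≤ f k R * g k R := fun k => mul_nonneg ((hf k).nonneg R hR) ((hg k).nonneg R hR)
  have hT0 : 0 ≤ T := by
    have := hfg 0; have := hfg 2; have := hfg 3
    positivity
  have hfin : ∀ {B : Set (E n)}, B ⊆ Ω → volume B ≠ ⊤ := fun hB =>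
    measure_ne_top_of_subset hB hb.measure_lt_top.ne
  have hSΩ' : S ⊆ Ω := hSΩ.trans sdiff_subset
  -- It suffices to compare with a step function: `a` on `S`, `-T V³` on `Ω₀`, and `0` elsewhere.
  have hle : ∀ x ∈ Ω, S.indicator (fun _ => a) x - Ω₀.indicator (fun _ => T * V ^ 3) x
      ≤ rhs Ω Ω₀ φ ρ f g F ε u x * cutoff (u x - p x) := by
    intro x hx
    have hVx := neg_le_of_abs_le (hV x hx)
    by_cases hx0 : x ∈ Ω₀
    · have hxS : x ∉ S := fun h => (hSΩ h).2 hx0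
      have hx' : x ∉ Ω \ Ω₀ := fun h => h.2 hx0
      rw [indicator_of_notMem hxS, indicator_of_mem hx0, rhs, indicator_of_mem hx0,
        indicator_of_notMem hx', add_zero, zero_sub]
      refine le_trans ?_ (mul_le_eulerLagrange_mul hn hf hg hF hΩ hu hx hx0 (hpos x hx) (huR x hx0)
        (hgR x hx0) (cutoff_nonpos _))
      rw [← mul_neg]
      refine mul_le_mul_of_nonneg_left ?_ hT0
      rw [cutoff, neg_le_neg_iff]
      exact pow_le_pow_left₀ (le_max_right _ _)
        (max_le (by linarith) ((abs_nonneg _).trans (hV x hx))) 3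
    · rw [indicator_of_notMem hx0, rhs, indicator_of_notMem hx0,
        indicator_of_mem (show x ∈ Ω \ Ω₀ from ⟨hx, hx0⟩), zero_add, sub_zero, div_mul_eq_mul_div]
      by_cases hxS : x ∈ S
      · rw [indicator_of_mem hxS, ha]
        gcongr
        exact le_deriv_G_mul_cutoff hf hg hm (huS x hxS)
      · rw [indicator_of_notMem hxS]
        exact div_nonneg (deriv_G_mul_cutoff_nonneg hf hg _) hε.le
  have iS : IntegrableOn (S.indicator fun _ => a) Ω :=
    (integrableOn_const (hfin subset_rfl)).indicator hS
  have i0 : IntegrableOn (Ω₀.indicator fun _ => T * V ^ 3) Ω :=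
    (integrableOn_const (hfin subset_rfl)).indicator hΩ₀
  refine le_trans (le_of_eq ?_) (setIntegral_mono_on (iS.sub i0) hi hΩ.measurableSet hle)
  rw [Pi.sub_def, integral_sub iS i0, setIntegral_indicator hS, setIntegral_indicator hΩ₀,
    inter_eq_self_of_subset_right hSΩ', inter_eq_self_of_subset_right hΩ₀Ω, setIntegral_const,
    setIntegral_const, smul_eq_mul, smul_eq_mul]
  ring

lemma convex_homothety_le {Ω : Set (E n)} {u : E n → ℝ} (hu : ConvexOn ℝ Ω u) {x₀ y : E n}
    (hx₀ : x₀ ∈ Ω) (hy : y ∈ Ω) {τ : ℝ} (h0 : 0 ≤ τ) (h1 : τ ≤ 1) :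
    AffineMap.homothety x₀ τ y ∈ Ω ∧
      u (AffineMap.homothety x₀ τ y) ≤ (1 - τ) * u x₀ + τ * u y := by
  have e : AffineMap.homothety x₀ τ y = (1 - τ) • x₀ + τ • y := by
    rw [AffineMap.homothety_apply, vsub_eq_sub, vadd_eq_add]; module
  rw [e]
  exact ⟨hu.1 hx₀ hy (by linarith) h0 (by ring), hu.2 hx₀ hy (by linarith) h0 (by ring)⟩

/-- The lower bound on solutions, with a constant depending only on the geometric data. -/
lemma IsSolution.neg_le [Nontrivial (E n)] (hn : 0 < n) {Ω Ω₀ : Set (E n)} {φ ψ ρ : E n → ℝ}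
    {f g : Fin 4 → ℝ → ℝ} {F : E n → ℝ → E n → ℝ} {s ε : ℝ} {u w : E n → ℝ}
    (hsol : IsSolution Ω Ω₀ φ ψ ρ f g F s ε u w)
    (hf : ∀ k, IsGrowthFunction (f k)) (hg : ∀ k, IsGrowthFunction (g k))
    (hF : IsAdmissibleLagrangian Ω₀ f g F) (hΩ : IsOpen Ω) (hb : Bornology.IsBounded Ω)
    (hconv : Convex ℝ Ω) (hΩ₀ : MeasurableSet Ω₀) (hΩ₀Ω : Ω₀ ⊆ Ω)
    (hρ : IsUniformlyConvexDefiningFunction Ω ρ)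
    (hφ : ContDiffOn ℝ 2 φ Ω) (hφc : ContinuousOn φ (closure Ω)) (hφconv : ConvexOn ℝ (closure Ω) φ)
    (hu : ContDiffOn ℝ 3 u Ω) (hε : 0 < ε) (hε1 : ε < 1) {A d τ : ℝ} (hA0 : 0 ≤ A)
    (hA : ∀ x ∈ closure Ω, |φ x| ≤ A) (hd : 0 < d) (hball : ∀ x ∈ Ω₀, Metric.ball x d ⊆ Ω)
    (hτ0 : 0 < τ) (hτ1 : τ < 1) (hτ : volume.real Ω₀ < τ ^ n * volume.real Ω)
    {x₀ : E n} (hx₀ : x₀ ∈ closure Ω) (hmin : ∀ x ∈ closure Ω, u x₀ ≤ u x) :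
    -u x₀ ≤ 2 / (1 - τ) * ((2 * A + 3 + 8 / ((1 - τ) * d) + 2 / (1 - τ)) +
      4 * n * (3 * (2 / (1 - τ) + A + 1) ^ 2 * volume.real Ω +
        (2 / (1 - τ) + A + 1) ^ 3 * volume.real Ω₀) / (τ ^ n * volume.real Ω - volume.real Ω₀)) := by
  set κ := 1 - τ with hκ
  have hκ0 : 0 < κ := by linarith
  set c := 2 / κ + A + 1 with hc
  set μ₀ := τ ^ n * volume.real Ω - volume.real Ω₀ with hμ₀
  have hμ₀0 : 0 < μ₀ := by linarith
  set Q := 4 * n * (3 * c ^ 2 * volume.real Ω + c ^ 3 * volume.real Ω₀) / μ₀ with hQ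
  have hQ0 : 0 ≤ Q := by positivity
  set M := -u x₀ with hM
  -- Half of the depth `κ M` that convexity gives on the shrunken domain; the other half absorbs `A`
  -- and `|φ̃| ≤ A + 1`.
  set m := κ * M / 2 with hm
  -- Each summand is a threshold for `m`: the first gives depth `m` on `S` and `m ≥ 2`, the second
  -- `|Du| ≤ m²` on `Ω₀`, the third `|u| ≤ M ≤ m²`.
  set m₀ := 2 * A + 3 + 8 / (κ * d) + 2 / κ with hm₀
  have hMm : M = 2 / κ * m := by rw [hm]; field_simp
  rw [hMm]
  gcongr
  by_contra! hcon
  have hmm₀ : m₀ ≤ m := by linarith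
  have ha1 : 0 < 8 / (κ * d) := by positivity
  have ha2 : 0 < 2 / κ := by positivity
  have hm3 : 2 * A + 3 ≤ m := by linarith
  have hm1 : 1 ≤ m := by linarith
  have hmd : 8 / (κ * d) ≤ m := by linarith
  have hmκ : 2 / κ ≤ m := by linarith
  have hMm2 : M ≤ m ^ 2 := by rw [hMm, sq]; gcongr
  have hmM : m ≤ M := by
    rw [hMm]
    exact le_mul_of_one_le_left (by linarith) ((one_le_div hκ0).2 (by linarith))
  obtain ⟨cu, hcu, hsc⟩ := hsol.uniformly_convex
  have hucv : ConvexOn ℝ Ω u :=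
    UniformConvexOn.convexOn hsc fun r => by simp only [Pi.zero_apply]; positivity
  have hu2 : ContDiffOn ℝ 2 u Ω := hu.of_le (by norm_num)
  have hA' : ∀ x ∈ frontier Ω, u x ≤ A := fun x hx => by
    rw [hsol.u_boundary x hx]
    exact (le_abs_self _).trans (hA x (frontier_subset_closure hx))
  have huA : ∀ x ∈ closure Ω, u x ≤ A := fun x hx =>
    le_of_strictConvexOn hΩ hb hsol.continuousOn_u (hsc.strictConvexOn hcu) hA' hx
  -- On the boundary `u = φ ≥ -A`, whereas `M ≥ m > A`.
  have hx₀Ω : x₀ ∈ Ω := by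
    by_contra hxΩ
    have hxf : x₀ ∈ frontier Ω := by rw [hΩ.frontier_eq]; exact ⟨hx₀, hxΩ⟩
    have h1 := neg_le_of_abs_le (hA x₀ hx₀)
    rw [← hsol.u_boundary x₀ hxf] at h1
    linarith
  have huM : ∀ x ∈ Ω, |u x| ≤ M := fun x hx => by
    have h1 := huA x (subset_closure hx)
    have h2 := hmin x (subset_closure hx)
    rw [abs_le]; constructor <;> linarith
  set p := phiTilde φ ρ ε with hp
  have hpA : ∀ x ∈ Ω, |p x| ≤ A + 1 := fun x hx =>
    abs_phiTilde_le hΩ hρ hA hε.le hε1.le (subset_closure hx)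
  have hV : ∀ x ∈ Ω, |u x - p x| ≤ M + (A + 1) := fun x hx =>
    (abs_sub _ _).trans (add_le_add (huM x hx) (hpA x hx))
  have hVm : M + (A + 1) ≤ c * m := by
    rw [hMm, hc]
    have : (A + 1) * 1 ≤ (A + 1) * m := by gcongr
    linarith
  -- Points of the contracted copy are `(1 - τ) x₀ + τ y`, where convexity gives `u ≤ -2m + τ A`.
  set S := (AffineMap.homothety x₀ τ '' Ω) \ Ω₀ with hS
  have hSm : MeasurableSet S :=
    ((AffineMap.homothety_isOpenMap x₀ τ hτ0.ne' _ hΩ).measurableSet).diff hΩ₀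
  have hSΩ : S ⊆ Ω \ Ω₀ := by
    rintro _ ⟨⟨y, hy, rfl⟩, h2⟩
    exact ⟨(convex_homothety_le hucv hx₀Ω hy hτ0.le hτ1.le).1, h2⟩
  have huS : ∀ x ∈ S, u x - p x ≤ -m := by
    rintro _ ⟨⟨y, hy, rfl⟩, -⟩
    obtain ⟨h1, h2⟩ := convex_homothety_le hucv hx₀Ω hy hτ0.le hτ1.le
    have h3 := neg_le_of_abs_le (hpA _ h1)
    have h4 : τ * u y ≤ τ * A := by gcongr; exact huA y (subset_closure hy)
    have h5 : τ * A ≤ A := mul_le_of_le_one_left hA0 hτ1.le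
    have h6 : (1 - τ) * u x₀ = -(2 * m) := by rw [hm, hM, hκ]; ring
    linarith
  have hμ : μ₀ ≤ volume.real S := by
    have h1 : volume.real (AffineMap.homothety x₀ τ '' Ω) = τ ^ n * volume.real Ω := by
      rw [Measure.real, Measure.addHaar_image_homothety, finrank_euclideanSpace, Fintype.card_fin,
        ENNReal.toReal_mul, ENNReal.toReal_ofReal (abs_nonneg _), abs_of_pos (by positivity)]
      rfl
    rw [hμ₀, ← h1]
    exact le_measureReal_sdiff (measure_ne_top_of_subset hΩ₀Ω hb.measure_lt_top.ne)
  have hgR : ∀ x ∈ Ω₀, ‖gradient u x‖ ≤ m ^ 2 := fun x hx => by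
    refine (norm_gradient_le hucv hd (hball x hx) huM).trans ?_
    have e : 4 * M / d = 8 / (κ * d) * m := by rw [hMm]; field_simp; ring
    rw [e, sq]; gcongr
  obtain ⟨hint, hup⟩ := hsol.integral_rhs_mul_cutoff_le hΩ hb hconv hρ hφ hφc hφconv hu hε.le hV
  have hlow := le_integral_rhs_mul_cutoff hn hf hg hF hΩ hb hΩ₀ hΩ₀Ω hSm hSΩ hu2
    (fun x hx => (hess_posDef hΩ hu2 hcu hsc hx).posSemidef) hε hV (by linarith) huS
    (fun x hx => (huM x (hΩ₀Ω hx)).trans hMm2) hgR (sq_nonneg m) hint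
  have hfg : ∀ k, 0 ≤ f k (m ^ 2) * g k (m ^ 2) := fun k =>
    mul_nonneg ((hf k).nonneg _ (sq_nonneg m)) ((hg k).nonneg _ (sq_nonneg m))
  have hn1 : (1 : ℝ) ≤ n := by exact_mod_cast hn
  have h0 := hfg 0; have h2 := hfg 2; have h3 := hfg 3
  -- The design of `H`: at `R = m²` it dominates `R` times the Euler–Lagrange bound up to the factor
  -- `n`, which comes from summing the `F_{p_i z}` terms.
  have hTH : m ^ 2 * (f 0 (m ^ 2) * g 0 (m ^ 2) + f 2 (m ^ 2) * g 2 (m ^ 2)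
      + n * (m ^ 2 * (f 3 (m ^ 2) * g 3 (m ^ 2)))) ≤ n * H f g (m ^ 2) := by
    have e1 := mul_le_mul_of_nonneg_right hn1 h0
    have e2 := mul_le_mul_of_nonneg_right hn1 h2
    have e3 : f 0 (m ^ 2) * g 0 (m ^ 2) + f 2 (m ^ 2) * g 2 (m ^ 2)
        + n * (m ^ 2 * (f 3 (m ^ 2) * g 3 (m ^ 2))) ≤
        n * (1 + f 0 (m ^ 2) * g 0 (m ^ 2) + f 2 (m ^ 2) * g 2 (m ^ 2)
          + m ^ 2 * (f 3 (m ^ 2) * g 3 (m ^ 2))) := by linarith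
    exact (mul_le_mul_of_nonneg_left e3 (sq_nonneg m)).trans_eq (by rw [H]; ring)
  have := le_of_energy hε hε1 hm1 (le_H hf hg (sq_nonneg m)) (by positivity) hTH
    (by linarith : 0 ≤ M + (A + 1)) hVm (by linarith) measureReal_nonneg measureReal_nonneg
    hμ₀0 hμ (hlow.trans hup)
  linarith

end SingularAbreu

end

/-! ### Choice of the constants and conclusion. -/

theorem lemma2p2 (n : ℕ) (hn : 2 ≤ n)
    (Ω Ω₀ : Set (SingularAbreu.E n))
    (hΩ : SingularAbreu.IsSmoothDomain Ω) (hΩ_bdd : Bornology.IsBounded Ω) (hΩ_conv : Convex ℝ Ω)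
    (hΩ₀ : SingularAbreu.IsSmoothDomain Ω₀) (hΩ₀_conv : Convex ℝ Ω₀) (hΩ₀Ω : closure Ω₀ ⊆ Ω)
    (ρ : SingularAbreu.E n → ℝ) (hρ : SingularAbreu.IsUniformlyConvexDefiningFunction Ω ρ)
    (φ ψ : SingularAbreu.E n → ℝ)
    (hφ : ContDiffOn ℝ 5 φ (closure Ω)) (hφ_conv : ConvexOn ℝ (closure Ω) φ)
    (hψ : ContDiffOn ℝ 3 ψ (closure Ω)) (hψ_pos : ∀ x ∈ frontier Ω, 0 < ψ x)
    (f g : Fin 4 → ℝ → ℝ)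
    (hf : ∀ k, SingularAbreu.IsGrowthFunction (f k))
    (hg : ∀ k, SingularAbreu.IsGrowthFunction (g k)) :
    ∃ ε₀ : ℝ, 0 < ε₀ ∧ ε₀ < 1 ∧ ∀ s : ℝ, (n : ℝ) < s →
      ∃ C : ℝ, 0 < C ∧
        ∀ F : SingularAbreu.E n → ℝ → SingularAbreu.E n → ℝ,
          SingularAbreu.IsAdmissibleLagrangian Ω₀ f g F →
        ∀ ε : ℝ, 0 < ε → ε < ε₀ →
        ∀ u w : SingularAbreu.E n → ℝ,
          SingularAbreu.IsSolution Ω Ω₀ φ ψ ρ f g F s ε u w →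
          eLpNorm u ∞ (volume.restrict Ω) < ENNReal.ofReal C := by
  have hn0 : 0 < n := by omega
  have : Nonempty (Fin n) := ⟨⟨0, hn0⟩⟩
  have hΩo := hΩ.isOpen
  have hΩ₀Ω' : Ω₀ ⊆ Ω := subset_closure.trans hΩ₀Ω
  have hφc : ContinuousOn φ (closure Ω) := hφ.continuousOn
  have hφ2 : ContDiffOn ℝ 2 φ Ω := (hφ.mono subset_closure).of_le (by norm_num)
  obtain ⟨A, hA⟩ := hΩ_bdd.isCompact_closure.exists_bound_of_continuousOn hφc
  obtain ⟨z, hz⟩ := hΩ.isConnected.nonempty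
  have hA0 : 0 ≤ A := (norm_nonneg _).trans (hA z (subset_closure hz))
  have hΩ₀c : IsCompact (closure Ω₀) := (hΩ_bdd.subset hΩ₀Ω').isCompact_closure
  obtain ⟨d, hd, hdΩ⟩ := hΩ₀c.exists_thickening_subset_open hΩo hΩ₀Ω
  have hball : ∀ x ∈ Ω₀, Metric.ball x d ⊆ Ω := fun x hx =>
    (Metric.ball_subset_thickening (subset_closure hx) d).trans hdΩ
  obtain ⟨τ, hτ0, hτ1, hτ⟩ := SingularAbreu.exists_contraction_factor
    (SingularAbreu.measureReal_lt_of_closure_subset hΩo ⟨z, hz⟩ hΩ_bdd hΩ₀Ω) n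
  -- Any threshold in `(0, 1)` works, since the estimates only use `ε < 1`.
  refine ⟨1 / 2, by norm_num, by norm_num, fun s hs => ?_⟩
  set B := 2 / (1 - τ) * ((2 * A + 3 + 8 / ((1 - τ) * d) + 2 / (1 - τ)) +
      4 * n * (3 * (2 / (1 - τ) + A + 1) ^ 2 * volume.real Ω +
        (2 / (1 - τ) + A + 1) ^ 3 * volume.real Ω₀) / (τ ^ n * volume.real Ω - volume.real Ω₀))
  -- `A` bounds `u` from above and `B` bounds `-u`; the `1` makes the inequality strict.
  refine ⟨max A B + 1, by positivity, fun F hF ε hε hε' u w hsol => ?_⟩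
  have hs1 : (1 : ℝ) ≤ s := by
    have : (2 : ℝ) ≤ n := by exact_mod_cast hn
    linarith
  have hu : ContDiffOn ℝ 3 u Ω := SingularAbreu.MemSobolev.contDiffOn hΩo hΩ_bdd hs1 hs (k := 3)
    (hsol.continuousOn_u.mono subset_closure) hsol.memSobolev
  obtain ⟨x₀, hx₀, hmin⟩ := hΩ_bdd.isCompact_closure.exists_isMinOn ⟨z, subset_closure hz⟩
    hsol.continuousOn_u
  have hlow := hsol.neg_le hn0 hf hg hF hΩo hΩ_bdd hΩ_conv hΩ₀.isOpen.measurableSet hΩ₀Ω' hρ hφ2 hφc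
    hφ_conv hu hε (by linarith) hA0 hA hd hball hτ0 hτ1 hτ hx₀ fun x hx => hmin hx
  obtain ⟨c, hc, hsc⟩ := hsol.uniformly_convex
  have hup : ∀ x ∈ closure Ω, u x ≤ A := fun x hx =>
    SingularAbreu.le_of_strictConvexOn hΩo hΩ_bdd hsol.continuousOn_u (hsc.strictConvexOn hc)
      (fun y hy => by
        rw [hsol.u_boundary y hy]
        exact (le_abs_self _).trans (hA y (frontier_subset_closure hy))) hx
  have hbound : ∀ x ∈ Ω, ‖u x‖ ≤ max A B := fun x hx => by
    have h1 := hup x (subset_closure hx)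
    have h2 : u x₀ ≤ u x := hmin (subset_closure hx)
    rw [Real.norm_eq_abs, abs_le]
    constructor
    · linarith [le_max_right A B]
    · exact h1.trans (le_max_left A B)
  have hle : eLpNorm u ⊤ (volume.restrict Ω) ≤ ENNReal.ofReal (max A B) := by
    rw [eLpNorm_exponent_top]
    refine eLpNormEssSup_le_of_ae_bound ?_
    filter_upwards [ae_restrict_mem hΩo.measurableSet] with x hx using hbound x hx
  refine hle.trans_lt ((ENNReal.ofReal_lt_ofReal_iff (by positivity)).2 (by linarith))
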